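/- Conventions. All rings are commutative with unit, and "differential" refers to one fixed derivation, written $x\mapsto x'$. Differential ideals and differential subalgebras are those stable under the derivation, and homomorphisms of differential algebras commute with the derivations. For a differential field $F$, $F\{y_1,\dots,y_n\}$ is the polynomial ring over $F$ in the indeterminates $y_i^{(k)}$ ($1\le i\le n$, $k\ge 0$) with the derivation that extends that of $F$ and maps $y_i^{(k)}$ to $y_i^{(k+1)}$. For $\alpha\in F^n$, $f(\alpha)$ denotes the result of replacing each $y_i^{(k)}$ in $f$ by the $k$-th derivative of $\alpha_i$. For $A\in F\{y\}\setminus F$, $\operatorname{ord}A$ is the largest $r$ such that $y^{(r)}$ occurs in $A$, and $S_A=\partial A/\partial y^{(\operatorname{ord}A)}$; elements of $F$ have order $-\infty$. A maximal differential ideal is a maximal element among the proper differential ideals. An algebra $S$ is differentially finitely generated over a differential subalgebra $R$ if there are finitely many elements of $S$ which together with all their derivatives generate $S$ as an $R$-algebra. Theorem 3. Let $F$ be a differential field of characteristic $0$. The following are equivalent. (a) $F$ is differentially closed: for all $A,B\in F\{y\}$ with $B\ne 0$ and $\operatorname{ord}B<\operatorname{ord}A$ there is $\alpha\in F$ with $A(\alpha)=0$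 and $B(\alpha)\neq 0$. (b) If $A,B\in F\{y\}$ are such that $A$ is irreducible, $B$ is not divisible by $A$ and $\operatorname{ord}A\ge\operatorname{ord}B$, then there is $\alpha\in F$ with $A(\alpha)=0$, $B(\alpha)\ne0$ and $S_A(\alpha)\neq0$. (c) If $J$ is a prime differential ideal of $F\{y\}$ and $B\in F\{y\}\setminus J$, then there is $\alpha\in F$ with $f(\alpha)=0$ for all $f\in J$ and $B(\alpha)\ne0$. (d) The same as (c) for every radical differential ideal $J$ of $F\{y\}$. (e) For every $n\ge1$, every prime differential ideal $J$ of $F\{y_1,\dots,y_n\}$ and every $B\in F\{y_1,\dots,y_n\}\setminus J$ there is $\alpha\in F^n$ with $f(\alpha)=0$ for all $f\in J$ and $B(\alpha)\neq0$. (e$'$) The same as (e) for radical differential ideals $J$. (f) For every $n\ge1$ and every proper prime differential ideal $J$ of $F\{y_1,\dots,y_n\}$ there is $\alpha\in F^n$ with $f(\alpha)=0$ for all $f\in J$. (g) The same as (f) for all proper differential ideals $J$. (g$'$) The same as (f) for all proper radical differential ideals $J$. (h) The same as (f) for all maximal differential ideals $J$. (i) Let $S$ be a differential $\mathbb{Q}$-algebra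 without zero divisors, $b$ a non-zero element of $S$, and $R$ a differential subalgebra of $S$ over which $S$ is differentially finitely generated. Then there is a non-zero $a\in R$ such that any homomorphism of differential algebras $\varphi:R\to F$ with $\varphi(a)\neq0$ extends to a homomorphism of differential algebras $\psi:S\to F$ with $\psi(b)\neq0$. -/

import Mathlib

universe u v w

open scoped Differential

namespace DiffAlg

/-- The ring `R{y_i : i ∈ σ}` of differential polynomials: polynomials in the indeterminates
`y_i^(k)`, written `X (i, k)`, for `i : σ` and `k : ℕ`.  Thus `DiffPoly R (Fin n)` is
`R{y_1, …, y_n}` and `DiffPoly R (Fin 1)` is `R{y}`. -/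
abbrev DiffPoly (R : Type u) [CommRing R] (σ : Type w) : Type (max u w) :=
  MvPolynomial (σ × ℕ) R

noncomputable section

/-- The derivation of a polynomial ring over a differential ring that differentiates the
coefficients and kills the indeterminates. -/
def coeffDeriv (R : Type u) [CommRing R] [Differential R] (τ : Type w) :
    Derivation ℤ (MvPolynomial τ R) (MvPolynomial τ R) :=
  Derivation.mk'
    ({ toFun := fun P => ∑ m ∈ P.support, MvPolynomial.monomial m ((P.coeff m)′)
       map_zero' := by simp
       map_add' := fun P Q => by
         classical
         ext m
         simp only [MvPolynomial.coeff_add, MvPolynomial.coeff_sum, MvPolynomial.coeff_monomial,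
           Finset.sum_ite_eq', MvPolynomial.mem_support_iff]
         split_ifs <;> simp_all [← map_add] } :
        MvPolynomial τ R →+ MvPolynomial τ R).toIntLinearMap
    (fun P Q => by
      classical
      have hmon : ∀ (m : τ →₀ ℕ) (a : R),
          (∑ k ∈ (MvPolynomial.monomial m a).support,
            MvPolynomial.monomial k ((MvPolynomial.coeff k (MvPolynomial.monomial m a))′)) =
          MvPolynomial.monomial m (a′) := by
        intro m a
        ext k
        simp only [MvPolynomial.coeff_sum, MvPolynomial.coeff_monomial, Finset.sum_ite_eq',
          MvPolynomial.mem_support_iff]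
        split_ifs <;> simp_all
      induction P using MvPolynomial.induction_on' with
      | add P₁ P₂ h₁ h₂ => rw [add_mul, map_add, h₁, h₂, map_add]; simp only [smul_eq_mul]; ring
      | monomial m a =>
        induction Q using MvPolynomial.induction_on' with
        | add Q₁ Q₂ h₁ h₂ => rw [mul_add, map_add, h₁, h₂, map_add]; simp only [smul_eq_mul]; ring
        | monomial k b =>
          simp only [AddMonoidHom.coe_toIntLinearMap, AddMonoidHom.coe_mk, ZeroHom.coe_mk, hmon,
            MvPolynomial.monomial_mul, smul_eq_mul, Derivation.leibniz, map_add]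
          rw [add_comm k m])

/-- The derivation of `R{y_i : i ∈ σ}`: it extends the derivation of `R` and maps `y_i^(k)`
to `y_i^(k+1)`. -/
instance DiffPoly.instDifferential (R : Type u) [CommRing R] [Differential R] (σ : Type w) :
    Differential (DiffPoly R σ) :=
  ⟨coeffDeriv R (σ × ℕ) +
    (MvPolynomial.mkDerivation R
      (fun v : σ × ℕ => (MvPolynomial.X (v.1, v.2 + 1) : DiffPoly R σ))).restrictScalars ℤ⟩

theorem DiffPoly.deriv_C {R : Type u} [CommRing R] [Differential R] {σ : Type w} (a : R) :
    (MvPolynomial.C a : DiffPoly R σ)′ = MvPolynomial.C (a′) := by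
  classical
  change coeffDeriv R (σ × ℕ) (MvPolynomial.C a) +
    MvPolynomial.mkDerivation R _ (MvPolynomial.C a) = _
  rw [MvPolynomial.derivation_C, add_zero]
  change (∑ m ∈ (MvPolynomial.C a).support, MvPolynomial.monomial m
    ((MvPolynomial.coeff m (MvPolynomial.C a))′)) = _
  ext k
  simp only [MvPolynomial.coeff_sum, MvPolynomial.coeff_monomial, Finset.sum_ite_eq',
    MvPolynomial.mem_support_iff, MvPolynomial.coeff_C]
  split_ifs <;> simp_all

theorem DiffPoly.deriv_X {R : Type u} [CommRing R] [Differential R] {σ : Type w} (i : σ) (k : ℕ) :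
    (MvPolynomial.X (i, k) : DiffPoly R σ)′ = MvPolynomial.X (i, k + 1) := by
  classical
  change coeffDeriv R (σ × ℕ) (MvPolynomial.X (i, k)) +
    MvPolynomial.mkDerivation R _ (MvPolynomial.X (i, k)) = _
  rw [MvPolynomial.mkDerivation_X]
  have : coeffDeriv R (σ × ℕ) (MvPolynomial.X (i, k)) = 0 := by
    change (∑ m ∈ (MvPolynomial.X (i, k)).support, MvPolynomial.monomial m
      ((MvPolynomial.coeff m (MvPolynomial.X (i, k)))′)) = _
    refine Finset.sum_eq_zero fun m _ => ?_
    rw [MvPolynomial.coeff_X]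
    split_ifs <;> simp
  rw [this, zero_add]

/-- The value `f(α)` of a differential polynomial at the point `α = (α_i)`: each `y_i^(k)` is
replaced by the `k`-th derivative of `α_i`. -/
def evalAt {R : Type u} [CommRing R] [Differential R] {σ : Type w} (α : σ → R) :
    DiffPoly R σ →ₐ[R] R :=
  MvPolynomial.aeval fun v : σ × ℕ => (fun x : R => x′)^[v.2] (α v.1)

/-- The order of `A ∈ R{y}`: the largest `r` for which `y^(r)` is present in `A`; it is `⊥` for
the elements of `R`. -/
def ord {R : Type u} [CommRing R] (A : DiffPoly R (Fin 1)) : WithBot ℕ :=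
  A.vars.sup fun v => (v.2 : WithBot ℕ)

/-- The separant `∂A/∂y^(r)`, `r = ord A`, of `A ∈ R{y}` (it is `0` for `A ∈ R`). -/
def separant {R : Type u} [CommRing R] (A : DiffPoly R (Fin 1)) : DiffPoly R (Fin 1) :=
  MvPolynomial.pderiv (0, (ord A).unbotD 0) A

/-- Blum's axiom. -/
def IsDifferentiallyClosed (F : Type u) [Field F] [Differential F] : Prop :=
  ∀ A B : DiffPoly F (Fin 1), B ≠ 0 → ord B < ord A →
    ∃ α : F, evalAt (fun _ => α) A = 0 ∧ evalAt (fun _ => α) B ≠ 0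

/-- Differential ideals: ideals stable under the derivation. -/
def IsDifferentialIdeal {S : Type u} [CommRing S] [Differential S] (J : Ideal S) : Prop :=
  ∀ x ∈ J, x′ ∈ J

/-- Maximal elements among the proper differential ideals. -/
def IsMaximalDifferentialIdeal {S : Type u} [CommRing S] [Differential S] (J : Ideal S) : Prop :=
  Maximal (fun K : Ideal S => IsDifferentialIdeal K ∧ K ≠ ⊤) J

/-- `S` is differentially finitely generated over its subalgebra `R`: it is generated as an
algebra by `R` and all derivatives of finitely many elements. -/
def IsDifferentiallyFG {S : Type u} [CommRing S] [Algebra ℚ S] [Differential S]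
    (R : Subalgebra ℚ S) : Prop :=
  ∃ (n : ℕ) (x : Fin n → S),
    Algebra.adjoin R {s : S | ∃ (i : Fin n) (k : ℕ), s = (fun z : S => z′)^[k] (x i)} = ⊤

/-- Chevalley's extension property for `F`: let `S` be a differential `ℚ`-algebra without zero
divisors, `R` a differential subalgebra over which `S` is differentially finitely generated,
and `b ≠ 0` an element of `S`.  Then there is a non-zero `a ∈ R` such that each homomorphism of
differential algebras `φ : R → F` with `φ a ≠ 0` extends to such a homomorphism
`ψ : S → F` with `ψ b ≠ 0`. -/
def ChevalleyExtension (F : Type u) [Field F] [CharZero F] [Differential F] : Prop :=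
  ∀ (S : Type (max u v)) [CommRing S] [IsDomain S] [Algebra ℚ S] [Differential S]
    (R : Subalgebra ℚ S) (hR : ∀ x ∈ R, x′ ∈ R) (b : S),
    IsDifferentiallyFG R → b ≠ 0 →
    ∃ a : R, a ≠ 0 ∧
      ∀ φ : R →ₐ[ℚ] F, (∀ x : R, φ ⟨(x : S)′, hR x x.2⟩ = (φ x)′) → φ a ≠ 0 →
        ∃ ψ : S →ₐ[ℚ] F, (∀ s : S, ψ (s′) = (ψ s)′) ∧ (∀ x : R, ψ (x : S) = φ x) ∧ ψ b ≠ 0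

end

end DiffAlg

/-!
The conditions are linked by the implications (a) → (i) → (e) → (e′) → (d) → (b) → (a), together
with (d) ↔ (c) and (e) → (f) → (g) → (e′), (g) → (g′) → (f), (g) ↔ (h).

* (a) → (i) is the main step (`IsDifferentiallyClosed.exists_extension_of_surjective`), by
  induction on the number of generators.  Let `S` be generated over `R` by one element `x` and its
  derivatives.  If `x` satisfies a differential equation over `R`, take one, `A`, of least order
  `r` and, among those, of least degree in `y^(r)`.  All proper derivatives of `A` are linear in
  their highest `y^(k)`, with the separant of `A` as coefficient, so modulo the derivatives of `A`,
  and up to powers of the separant and of the initial of `A`, each differential polynomial that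
  vanishes at `x` is zero.  Hence a zero of `A` in `F` at which the separant and the initial do not
  vanish yields a homomorphism on `S`.  The separant, the initial and a reduced form of `b` do not
  vanish at `x`, and `x^(r)` is algebraic over what precedes it, so the ideal generated by `A` and
  their product contains a non-zero element `d` of order less than `r`.  Blum's axiom for `A` and
  `d` provides the zero, and the element `a ∈ R` is a coefficient of `d` times the initial.
* (i) → (e) is the case `S = F{y_1, …, y_n} / J`, `R = F`.
* Statements about prime differential ideals pass to radical and to arbitrary proper differential
  ideals since over `ℚ` a differential ideal that is maximal among those avoiding the powers of an
  element is prime (`IsDifferentialIdeal.exists_prime`).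
* (d) → (b) and (g) → (e′) both need that certain differential ideals are proper, or avoid a given
  element.  This is shown with homomorphisms into a field that are not differential: a zero of `A`
  at which the separant of `A` does not vanish can be prolonged, one derivative at a time, to a
  zero of all derivatives of `A` (`exists_ringHom_iterate_deriv_eq_zero`).  For (d) → (b) it is
  applied to the generic zero of an irreducible `A`, for (g) → (e′) to `A = B z - 1` with a new
  indeterminate `z`, as in Rabinowitsch's trick.
* (b) → (a): replace `A` by an irreducible factor that involves its highest derivative.
-/

namespace DiffAlg

/-! ### Differential homomorphisms out of rings of differential polynomials -/

/-- The homomorphism `R{y_i : i ∈ σ} → S` that acts as `ι` on the coefficients and maps `y_i^(k)`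
to the `k`-th derivative of `x_i`. -/
noncomputable def evalHom {R S σ : Type*} [CommRing R] [CommRing S] [Differential S]
    (ι : R →+* S) (x : σ → S) : DiffPoly R σ →+* S :=
  MvPolynomial.eval₂Hom ι fun v => (fun z : S => z′)^[v.2] (x v.1)

section EvalHom

variable {R S T σ : Type*} [CommRing R] [CommRing S] [Differential S] [CommRing T] [Differential T]

@[simp]
theorem evalHom_C (ι : R →+* S) (x : σ → S) (a : R) :
    evalHom ι x (MvPolynomial.C a) = ι a := by
  simp [evalHom]

@[simp]
theorem evalHom_X (ι : R →+* S) (x : σ → S) (v : σ × ℕ) :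
    evalHom ι x (MvPolynomial.X v) = (fun z : S => z′)^[v.2] (x v.1) := by
  simp [evalHom]

theorem evalAt_eq_evalHom {R σ : Type*} [CommRing R] [Differential R] (α : σ → R)
    (f : DiffPoly R σ) : evalAt α f = evalHom (RingHom.id R) α f := rfl

/-- A homomorphism out of `R{y_i : i ∈ σ}` is differential if it commutes with the derivations on
coefficients and indeterminates. -/
theorem map_deriv_of_forall_X [Differential R] (E : DiffPoly R σ →+* S)
    (hC : ∀ a : R, E (MvPolynomial.C (a′)) = (E (MvPolynomial.C a))′)
    (hX : ∀ (i : σ) (k : ℕ), E (MvPolynomial.X (i, k + 1)) = (E (MvPolynomial.X (i, k)))′)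
    (f : DiffPoly R σ) : E (f′) = (E f)′ := by
  induction f using MvPolynomial.induction_on with
  | C a => rw [DiffPoly.deriv_C, hC]
  | add p q hp hq => simp only [map_add, hp, hq]
  | mul_X p v hp =>
    obtain ⟨i, k⟩ := v
    simp only [Derivation.leibniz, smul_eq_mul, map_add, map_mul, hp, DiffPoly.deriv_X, hX]

theorem evalHom_deriv [Differential R] (ι : R →+* S) (hι : ∀ a, ι (a′) = (ι a)′) (x : σ → S)
    (f : DiffPoly R σ) : evalHom ι x (f′) = (evalHom ι x f)′ :=
  map_deriv_of_forall_X _ (by simp [hι]) (by simp [Function.iterate_succ_apply']) f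

theorem map_iterate_deriv [Differential R] (E : R →+* S) (hE : ∀ f, E (f′) = (E f)′) (s : ℕ)
    (f : R) : E ((fun z => z′)^[s] f) = (fun z => z′)^[s] (E f) := by
  induction s with
  | zero => rfl
  | succ s ih => simp only [Function.iterate_succ_apply', hE, ih]

theorem iterate_deriv_zero (s : ℕ) : (fun z : S => z′)^[s] 0 = 0 := by
  induction s with
  | zero => rfl
  | succ s ih => simp only [Function.iterate_succ_apply', ih, map_zero]

theorem iterate_deriv_X [Differential R] (i : σ) (k s : ℕ) :
    (fun z => z′)^[s] (MvPolynomial.X (i, k) : DiffPoly R σ) = MvPolynomial.X (i, k + s) := by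
  induction s with
  | zero => rfl
  | succ s ih => rw [Function.iterate_succ_apply', ih, DiffPoly.deriv_X, add_assoc]

/-- A differential homomorphism out of `R{y_i : i ∈ σ}` is determined by its values on `R` and on
the `y_i`. -/
theorem eq_evalHom [Differential R] (ψ : DiffPoly R σ →+* S) (hψ : ∀ f, ψ (f′) = (ψ f)′)
    (f : DiffPoly R σ) :
    ψ f = evalHom (ψ.comp MvPolynomial.C) (fun i => ψ (MvPolynomial.X (i, 0))) f := by
  induction f using MvPolynomial.induction_on with
  | C a => simp
  | add p q hp hq => simp only [map_add, hp, hq]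
  | mul_X p v hp =>
    obtain ⟨i, k⟩ := v
    have := map_iterate_deriv ψ hψ k (MvPolynomial.X (i, 0))
    rw [iterate_deriv_X, zero_add] at this
    rw [map_mul, map_mul, hp, evalHom_X, this]

theorem evalHom_eq_evalAt_map {F : Type*} [CommRing F] [Differential F] (φ : R →+* F) (α : σ → F)
    (f : DiffPoly R σ) : evalHom φ α f = evalAt α (MvPolynomial.map φ f) := by
  rw [evalAt_eq_evalHom, evalHom, evalHom, MvPolynomial.coe_eval₂Hom, MvPolynomial.coe_eval₂Hom,
    MvPolynomial.eval₂_map, RingHom.id_comp]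

theorem rename_deriv {σ τ : Type*} [Differential R] (e : σ → τ) (f : DiffPoly R σ) :
    MvPolynomial.rename (Prod.map e id) (f′) =
      (MvPolynomial.rename (Prod.map e id) f : DiffPoly R τ)′ :=
  map_deriv_of_forall_X (MvPolynomial.rename (R := R) (Prod.map e id)).toRingHom
    (by simp [DiffPoly.deriv_C]) (by simp [DiffPoly.deriv_X]) f

theorem evalAt_rename {σ τ : Type*} [Differential R] (e : σ → τ) (α : τ → R) (f : DiffPoly R σ) :
    evalAt α (MvPolynomial.rename (Prod.map e id) f) = evalAt (α ∘ e) f := by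
  rw [evalAt, evalAt, MvPolynomial.aeval_rename]
  rfl

end EvalHom

/-! ### Differential polynomials of bounded order in one indeterminate -/

/-- The subalgebra of the differential polynomials in which `y_i^(k)` does not occur for
`k ≥ m`; the order in the other indeterminates is not restricted. -/
noncomputable def orderLT (R : Type*) [CommRing R] {σ : Type*} (i : σ) (m : ℕ) :
    Subalgebra R (DiffPoly R σ) :=
  MvPolynomial.supported R {v : σ × ℕ | v.1 = i → v.2 < m}

section OrderLT

variable {R σ : Type*} [CommRing R] {i : σ}

theorem orderLT_mono {m n : ℕ} (h : m ≤ n) : orderLT R i m ≤ orderLT R i n :=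
  MvPolynomial.supported_mono fun _ hv hi => (hv hi).trans_le h

theorem mem_orderLT_iff {m : ℕ} {f : DiffPoly R σ} :
    f ∈ orderLT R i m ↔ ∀ k, (i, k) ∈ f.vars → k < m := by
  rw [orderLT, MvPolynomial.mem_supported]
  constructor
  · exact fun h k hk => h hk rfl
  · rintro h ⟨j, k⟩ hv rfl
    exact h k hv

theorem X_mem_orderLT {j : σ} {k m : ℕ} (h : j = i → k < m) :
    (MvPolynomial.X (j, k) : DiffPoly R σ) ∈ orderLT R i m :=
  Algebra.subset_adjoin ⟨(j, k), h, rfl⟩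

theorem orderLT_induction {m : ℕ} {p : DiffPoly R σ → Prop}
    (C : ∀ a, p (MvPolynomial.C a))
    (X : ∀ j k, (j = i → k < m) → p (MvPolynomial.X (j, k)))
    (add : ∀ f g, f ∈ orderLT R i m → g ∈ orderLT R i m → p f → p g → p (f + g))
    (mul : ∀ f g, f ∈ orderLT R i m → g ∈ orderLT R i m → p f → p g → p (f * g))
    {f : DiffPoly R σ} (hf : f ∈ orderLT R i m) : p f := by
  refine Algebra.adjoin_induction (p := fun f _ => p f) ?_ (fun a => C a)
    (fun f g hf hg => add f g hf hg) (fun f g hf hg => mul f g hf hg) hf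
  rintro _ ⟨⟨j, k⟩, hv, rfl⟩
  exact X j k hv

theorem ringHom_eq_of_mem_orderLT {L : Type*} [CommRing L] {m : ℕ} (θ θ' : DiffPoly R σ →+* L)
    (hC : ∀ a, θ (MvPolynomial.C a) = θ' (MvPolynomial.C a))
    (hX : ∀ j k, (j = i → k < m) → θ (MvPolynomial.X (j, k)) = θ' (MvPolynomial.X (j, k)))
    {f : DiffPoly R σ} (hf : f ∈ orderLT R i m) : θ f = θ' f :=
  orderLT_induction (p := fun f => θ f = θ' f) hC hX
    (fun f g _ _ h₁ h₂ => by rw [map_add, map_add, h₁, h₂])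
    (fun f g _ _ h₁ h₂ => by rw [map_mul, map_mul, h₁, h₂]) hf

theorem pderiv_mem_orderLT {m : ℕ} {f : DiffPoly R σ} (hf : f ∈ orderLT R i m) (v : σ × ℕ) :
    MvPolynomial.pderiv v f ∈ orderLT R i m := by
  classical
  refine orderLT_induction (p := fun f => MvPolynomial.pderiv v f ∈ orderLT R i m)
    (fun a => by simp) (fun j k _ => ?_) (fun f g _ _ h₁ h₂ => ?_) (fun f g hf hg h₁ h₂ => ?_) hf
  · by_cases h : v = (j, k)
    · subst h; simp [one_mem]
    · rw [MvPolynomial.pderiv_X_of_ne (Ne.symm h)]; exact zero_mem _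
  · rw [map_add]; exact add_mem h₁ h₂
  · rw [MvPolynomial.pderiv_mul]; exact add_mem (mul_mem h₁ hg) (mul_mem hf h₂)

theorem pderiv_eq_zero_of_mem_orderLT {m : ℕ} {f : DiffPoly R σ} (hf : f ∈ orderLT R i m) :
    MvPolynomial.pderiv (i, m) f = 0 :=
  MvPolynomial.pderiv_eq_zero_of_notMem_vars fun h => lt_irrefl _ (mem_orderLT_iff.1 hf _ h)

variable [Differential R]

/-- The derivative of a polynomial is linear in the highest derivative of `y_i`, with the partial
derivative (the separant) as its coefficient. -/
theorem exists_deriv_eq {m : ℕ} {f : DiffPoly R σ} (hf : f ∈ orderLT R i (m + 1)) :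
    ∃ g ∈ orderLT R i (m + 1),
      f′ = MvPolynomial.pderiv (i, m) f * MvPolynomial.X (i, m + 1) + g := by
  classical
  refine orderLT_induction (p := fun f => ∃ g ∈ orderLT R i (m + 1),
      f′ = MvPolynomial.pderiv (i, m) f * MvPolynomial.X (i, m + 1) + g)
    (fun a => ?_) (fun j k h => ?_) ?_ ?_ hf
  · exact ⟨MvPolynomial.C (a′), Subalgebra.algebraMap_mem _ _, by simp [DiffPoly.deriv_C]⟩
  · rw [DiffPoly.deriv_X]
    by_cases hjk : (j, k) = (i, m)
    · obtain ⟨rfl, rfl⟩ := Prod.ext_iff.1 hjk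
      exact ⟨0, zero_mem _, by simp⟩
    · refine ⟨MvPolynomial.X (j, k + 1), X_mem_orderLT fun hj => ?_, ?_⟩
      · have := h hj
        have : k ≠ m := fun hk => hjk (by rw [hj, hk])
        omega
      · rw [MvPolynomial.pderiv_X_of_ne hjk, zero_mul, zero_add]
  · rintro f₁ f₂ - - ⟨g₁, hg₁, h₁⟩ ⟨g₂, hg₂, h₂⟩
    exact ⟨g₁ + g₂, add_mem hg₁ hg₂, by rw [map_add, map_add, h₁, h₂]; ring⟩
  · rintro f₁ f₂ hf₁ hf₂ ⟨g₁, hg₁, h₁⟩ ⟨g₂, hg₂, h₂⟩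
    exact ⟨f₁ * g₂ + f₂ * g₁, add_mem (mul_mem hf₁ hg₂) (mul_mem hf₂ hg₁), by
      rw [Derivation.leibniz, MvPolynomial.pderiv_mul, h₁, h₂, smul_eq_mul, smul_eq_mul]; ring⟩

theorem deriv_mem_orderLT {m : ℕ} {f : DiffPoly R σ} (hf : f ∈ orderLT R i m) :
    f′ ∈ orderLT R i (m + 1) := by
  obtain ⟨g, hg, h⟩ := exists_deriv_eq (orderLT_mono m.le_succ hf)
  rw [h, pderiv_eq_zero_of_mem_orderLT hf, zero_mul, zero_add]
  exact hg

/-- All proper derivatives of `P` have the same separant. -/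
theorem exists_iterate_deriv_eq {r : ℕ} {P : DiffPoly R σ} (hP : P ∈ orderLT R i (r + 1)) (s : ℕ) :
    ∃ T ∈ orderLT R i (r + s + 1), (fun z => z′)^[s + 1] P =
      MvPolynomial.pderiv (i, r) P * MvPolynomial.X (i, r + s + 1) + T := by
  induction s with
  | zero => exact exists_deriv_eq hP
  | succ s ih =>
    obtain ⟨T, hT, h⟩ := ih
    refine ⟨(MvPolynomial.pderiv (i, r) P)′ * MvPolynomial.X (i, r + s + 1) + T′,
      add_mem (mul_mem ?_ (X_mem_orderLT fun _ => by omega)) (deriv_mem_orderLT hT), ?_⟩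
    · exact orderLT_mono (by omega) (deriv_mem_orderLT (pderiv_mem_orderLT hP _))
    · rw [Function.iterate_succ_apply', h, map_add, Derivation.leibniz, DiffPoly.deriv_X]
      simp only [smul_eq_mul, ← add_assoc]
      ring

/-- A zero of `P` in a field at which the separant does not vanish prolongs to a zero of all
derivatives of `P`: these are linear in the derivatives of `y_i` that are still free, with the
separant as leading coefficient.  The prolonged homomorphism is not differential. -/
theorem exists_ringHom_iterate_deriv_eq_zero {L : Type*} [Field L] {r : ℕ} {P : DiffPoly R σ}
    (hP : P ∈ orderLT R i (r + 1)) (θ₀ : DiffPoly R σ →+* L) (h₀ : θ₀ P = 0)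
    (hS : θ₀ (MvPolynomial.pderiv (i, r) P) ≠ 0) :
    ∃ θ : DiffPoly R σ →+* L, (∀ f ∈ orderLT R i (r + 1), θ f = θ₀ f) ∧
      ∀ s, θ ((fun z => z′)^[s] P) = 0 := by
  classical
  choose T hT hPT using exists_iterate_deriv_eq hP
  let ι : R →+* L := θ₀.comp MvPolynomial.C
  -- `c s` holds the values of the indeterminates after `s` derivatives of `P` have been treated
  let c : ℕ → σ × ℕ → L := fun s => Nat.rec (fun v => θ₀ (MvPolynomial.X v))
    (fun s c => Function.update c (i, r + s + 1)
      (-MvPolynomial.eval₂Hom ι c (T s) / θ₀ (MvPolynomial.pderiv (i, r) P))) s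
  have hc : ∀ s, c (s + 1) = Function.update (c s) (i, r + s + 1)
      (-MvPolynomial.eval₂Hom ι (c s) (T s) / θ₀ (MvPolynomial.pderiv (i, r) P)) := fun _ => rfl
  have hstab : ∀ j k s, (j = i → k < r + s + 1) → ∀ t, c (s + t) (j, k) = c s (j, k) := by
    intro j k s h t
    induction t with
    | zero => rfl
    | succ t ih =>
      rw [← add_assoc, hc, Function.update_of_ne, ih]
      intro hjk
      obtain ⟨hj, hk⟩ := Prod.ext_iff.1 hjk
      have := h hj
      simp only at hk
      omega
  let θ : DiffPoly R σ →+* L := MvPolynomial.eval₂Hom ι fun v => c v.2 v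
  have hθ : ∀ s, ∀ f ∈ orderLT R i (r + s + 1), θ f = MvPolynomial.eval₂Hom ι (c s) f := by
    intro s f hf
    refine ringHom_eq_of_mem_orderLT _ _ (fun a => by simp [θ]) (fun j k h => ?_) hf
    simp only [θ, MvPolynomial.eval₂Hom_X']
    rcases le_total k s with hks | hks
    · obtain ⟨t, rfl⟩ := Nat.exists_eq_add_of_le hks
      exact (hstab j k k (fun _ => by omega) t).symm
    · obtain ⟨t, rfl⟩ := Nat.exists_eq_add_of_le hks
      exact hstab j _ s h t
  have hθ₀ : ∀ f ∈ orderLT R i (r + 1), θ f = θ₀ f := by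
    intro f hf
    rw [hθ 0 f hf]
    exact ringHom_eq_of_mem_orderLT _ _ (fun a => by simp [ι]) (fun j k _ => by simp [c]) hf
  refine ⟨θ, hθ₀, fun s => ?_⟩
  rcases s with _ | s
  · rw [Function.iterate_zero_apply, hθ₀ P hP, h₀]
  · have hX : θ (MvPolynomial.X (i, r + s + 1)) =
        -θ (T s) / θ₀ (MvPolynomial.pderiv (i, r) P) := by
      rw [hθ (s + 1) _ (X_mem_orderLT fun _ => by omega), hθ s _ (hT s), MvPolynomial.eval₂Hom_X',
        hc, Function.update_self]
    rw [hPT, map_add, map_mul, hθ₀ _ (pderiv_mem_orderLT hP _), hX]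
    field_simp
    ring

end OrderLT

/-! ### Differential ideals -/

section Ideals

variable {S : Type*} [CommRing S] [Differential S]

theorem IsDifferentialIdeal.span {s : Set S} (h : ∀ x ∈ s, x′ ∈ Ideal.span s) :
    IsDifferentialIdeal (Ideal.span s) := by
  intro x hx
  refine Submodule.span_induction (p := fun x _ => x′ ∈ Ideal.span s) h (by simp)
    (fun x y _ _ hx hy => by rw [map_add]; exact add_mem hx hy) (fun a x hx' hx => ?_) hx
  rw [smul_eq_mul, Derivation.leibniz]
  exact add_mem (Ideal.mul_mem_left _ _ hx) (Ideal.mul_mem_right _ _ hx')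

theorem isDifferentialIdeal_span_iterate (P : S) :
    IsDifferentialIdeal (Ideal.span (Set.range fun s => (fun z : S => z′)^[s] P)) :=
  .span <| by
    rintro _ ⟨s, rfl⟩
    exact Ideal.subset_span ⟨s + 1, Function.iterate_succ_apply' ..⟩

theorem map_eq_zero_of_mem_span_iterate {T : Type*} [CommRing T] [Differential T] {E : S →+* T}
    (hE : ∀ f, E (f′) = (E f)′) {P f : S} (hP : E P = 0)
    (hf : f ∈ Ideal.span (Set.range fun s => (fun z : S => z′)^[s] P)) : E f = 0 := by
  refine (Ideal.span_le (I := RingHom.ker E)).2 ?_ hf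
  rintro _ ⟨s, rfl⟩
  exact (map_iterate_deriv E hE s P).trans (by rw [hP, iterate_deriv_zero])

/-- The radical of a differential ideal is differential; this needs `ℚ ⊆ S`. -/
theorem IsDifferentialIdeal.radical [Algebra ℚ S] {J : Ideal S} (hJ : IsDifferentialIdeal J) :
    IsDifferentialIdeal J.radical := by
  rintro x ⟨n, hx⟩
  suffices ∀ m j, x ^ m * x′ ^ j ∈ J → x′ ∈ J.radical from this n 0 (by simpa using hx)
  intro m
  induction m with
  | zero => exact fun j h => ⟨j, by simpa using h⟩
  | succ m ih =>
    intro j h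
    refine ih (j + 2) ?_
    have h1 := Ideal.mul_mem_right (x′) J (hJ _ h)
    rw [Derivation.leibniz, Derivation.leibniz_pow, Derivation.leibniz_pow] at h1
    simp only [smul_eq_mul, nsmul_eq_mul, Nat.add_sub_cancel] at h1
    have h2 : (x ^ (m + 1) * (↑j * (x′ ^ (j - 1) * x′′)) + x′ ^ j * (((m + 1 : ℕ) : S) *
        (x ^ m * x′))) * x′ =
        j * x′′ * (x ^ (m + 1) * x′ ^ j) + ((m + 1 : ℕ) : S) * (x ^ m * x′ ^ (j + 2)) := by
      rcases j with _ | j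
      · simp; ring
      · simp only [Nat.add_sub_cancel]; ring
    rw [h2] at h1
    have h3 := (Ideal.add_mem_iff_right _ (Ideal.mul_mem_left _ _ h)).1 h1
    have h4 := Ideal.mul_mem_left J (algebraMap ℚ S ((m + 1 : ℕ) : ℚ)⁻¹) h3
    rwa [← mul_assoc, ← map_natCast (algebraMap ℚ S), ← map_mul, inv_mul_cancel₀
      (by positivity), map_one, one_mul] at h4

/-- Zorn's lemma for the differential ideals that avoid the powers of `B`. -/
theorem IsDifferentialIdeal.exists_maximal {J : Ideal S} (hJ : IsDifferentialIdeal J) {B : S}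
    (hB : B ∉ J.radical) :
    ∃ M, J ≤ M ∧ Maximal (fun K : Ideal S => IsDifferentialIdeal K ∧ B ∉ K.radical) M := by
  refine zorn_le_nonempty₀ {K : Ideal S | IsDifferentialIdeal K ∧ B ∉ K.radical} ?_ J ⟨hJ, hB⟩
  intro c hc hchain K hK
  have hmem : ∀ x, x ∈ sSup c ↔ ∃ I ∈ c, x ∈ I := fun x =>
    Submodule.mem_sSup_of_directed ⟨K, hK⟩ hchain.directedOn
  refine ⟨sSup c, ⟨fun x hx => ?_, ?_⟩, fun I hI => le_sSup hI⟩
  · obtain ⟨I, hI, hxI⟩ := (hmem x).1 hx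
    exact (hmem _).2 ⟨I, hI, (hc hI).1 x hxI⟩
  · rintro ⟨n, hn⟩
    obtain ⟨I, hI, hxI⟩ := (hmem _).1 hn
    exact (hc hI).2 ⟨n, hxI⟩

/-- The quotient of a radical differential ideal by an element is differential. -/
theorem IsDifferentialIdeal.mul_deriv_mem {J : Ideal S} (hJ : IsDifferentialIdeal J)
    (hr : J.IsRadical) {x y : S} (h : x * y ∈ J) : x * y′ ∈ J := by
  refine hr ⟨2, ?_⟩
  have h1 := Ideal.mul_mem_left J (x * y′) (hJ _ h)
  rw [Derivation.leibniz, smul_eq_mul, smul_eq_mul] at h1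
  have h2 : (x * y′) ^ 2 = x * y′ * (x * y′ + y * x′) - y′ * x′ * (x * y) := by ring
  rw [h2]
  exact sub_mem h1 (Ideal.mul_mem_left _ _ h)

/-- Radical differential ideals are intersections of prime differential ideals. -/
theorem IsDifferentialIdeal.exists_prime [Algebra ℚ S] {J : Ideal S} (hJ : IsDifferentialIdeal J)
    {B : S} (hB : B ∉ J.radical) :
    ∃ P, J ≤ P ∧ IsDifferentialIdeal P ∧ P.IsPrime ∧ B ∉ P := by
  obtain ⟨P, hJP, hP⟩ := hJ.exists_maximal hB
  have hrad : P.IsRadical := by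
    refine hP.le_of_ge ⟨hP.prop.1.radical, ?_⟩ Ideal.le_radical
    rw [Ideal.radical_idem]
    exact hP.prop.2
  -- if `x * y ∈ P` and `y ∉ P`, then `P : x` is a differential ideal strictly larger than `P`,
  -- so it contains a power of `B`
  have key : ∀ x y : S, x * y ∈ P → y ∉ P → x * B ∈ P := by
    intro x y hxy hy
    let K : Ideal S := Submodule.comap (LinearMap.mulLeft S x) P
    have hKmem : ∀ z, z ∈ K ↔ x * z ∈ P := fun z => Iff.rfl
    have hPK : P ≤ K := fun z hz => Ideal.mul_mem_left _ _ hz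
    have hK : IsDifferentialIdeal K := fun z hz => hP.prop.1.mul_deriv_mem hrad hz
    by_contra hB'
    refine hy (hP.le_of_ge ⟨hK, ?_⟩ hPK hxy)
    rintro ⟨n, hn⟩
    refine hB' (hrad ⟨n + 1, ?_⟩)
    have : (x * B) ^ (n + 1) = x ^ n * B * (x * B ^ n) := by ring
    rw [this]
    exact Ideal.mul_mem_left _ _ hn
  have hBP : B ∉ P := fun h => hP.prop.2 (Ideal.le_radical h)
  refine ⟨P, hJP, hP.prop.1, ⟨fun h => hBP (h ▸ Submodule.mem_top), fun {x y} hxy => ?_⟩, hBP⟩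
  by_contra! h
  have h1 := key x y hxy h.2
  rw [mul_comm] at h1
  exact hBP (hrad ⟨2, by rw [sq]; exact key B x h1 h.1⟩)

end Ideals

/-! ### Reduction modulo the derivatives of a differential polynomial -/

/-- Modulo the differential ideal generated by `P`, of order `r` in `y_i`, a power of the separant
brings each differential polynomial down to order at most `r` in `y_i`. -/
theorem exists_separant_pow_mul_sub_mem {R σ : Type*} [CommRing R] [Differential R] {i : σ} {r : ℕ}
    {P : DiffPoly R σ} (hP : P ∈ orderLT R i (r + 1)) (f : DiffPoly R σ) :
    ∃ k, ∃ g ∈ orderLT R i (r + 1), MvPolynomial.pderiv (i, r) P ^ k * f - g ∈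
      Ideal.span (Set.range fun s => (fun z : DiffPoly R σ => z′)^[s] P) := by
  set S := MvPolynomial.pderiv (i, r) P with hS
  have hSmem : S ∈ orderLT R i (r + 1) := pderiv_mem_orderLT hP _
  suffices h : ∀ m, ∀ f ∈ orderLT R i (r + m + 1), ∃ k, ∃ g ∈ orderLT R i (r + 1), S ^ k * f - g ∈
      Ideal.span (Set.range fun s => (fun z : DiffPoly R σ => z′)^[s] P) by
    refine h (f.vars.sup Prod.snd) f (mem_orderLT_iff.2 fun k hk => ?_)
    have : k ≤ f.vars.sup Prod.snd := Finset.le_sup (f := Prod.snd) hk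
    omega
  intro m
  induction m with
  | zero => exact fun f hf => ⟨0, f, hf, by simp⟩
  | succ m ih =>
    intro f hf
    refine orderLT_induction (p := fun f => ∃ k, ∃ g ∈ orderLT R i (r + 1), S ^ k * f - g ∈
      Ideal.span (Set.range fun s => (fun z : DiffPoly R σ => z′)^[s] P))
      (fun a => ⟨0, MvPolynomial.C a, Subalgebra.algebraMap_mem _ _, by simp⟩)
      (fun j k h => ?_) ?_ ?_ hf
    · by_cases hjk : j = i → k < r + m + 1
      · exact ih _ (X_mem_orderLT hjk)
      · obtain ⟨rfl, hk⟩ := Classical.not_imp.1 hjk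
        obtain rfl : k = r + m + 1 := by have := h rfl; omega
        obtain ⟨T, hT, hPT⟩ := exists_iterate_deriv_eq hP m
        obtain ⟨k, g, hg, hk⟩ := ih T hT
        refine ⟨k + 1, -g, neg_mem hg, ?_⟩
        have : S ^ (k + 1) * MvPolynomial.X (j, r + m + 1) - -g =
            S ^ k * (fun z : DiffPoly R σ => z′)^[m + 1] P - (S ^ k * T - g) := by
          rw [hPT]; ring
        rw [this]
        exact sub_mem (Ideal.mul_mem_left _ _ (Ideal.subset_span ⟨m + 1, rfl⟩)) hk
    · rintro f₁ f₂ - - ⟨k₁, g₁, hg₁, h₁⟩ ⟨k₂, g₂, hg₂, h₂⟩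
      refine ⟨k₁ + k₂, S ^ k₂ * g₁ + S ^ k₁ * g₂,
        add_mem (mul_mem (pow_mem hSmem _) hg₁) (mul_mem (pow_mem hSmem _) hg₂), ?_⟩
      have : S ^ (k₁ + k₂) * (f₁ + f₂) - (S ^ k₂ * g₁ + S ^ k₁ * g₂) =
          S ^ k₂ * (S ^ k₁ * f₁ - g₁) + S ^ k₁ * (S ^ k₂ * f₂ - g₂) := by ring
      rw [this]
      exact add_mem (Ideal.mul_mem_left _ _ h₁) (Ideal.mul_mem_left _ _ h₂)
    · rintro f₁ f₂ - - ⟨k₁, g₁, hg₁, h₁⟩ ⟨k₂, g₂, hg₂, h₂⟩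
      refine ⟨k₁ + k₂, g₁ * g₂, mul_mem hg₁ hg₂, ?_⟩
      have : S ^ (k₁ + k₂) * (f₁ * f₂) - g₁ * g₂ =
          S ^ k₂ * f₂ * (S ^ k₁ * f₁ - g₁) + g₁ * (S ^ k₂ * f₂ - g₂) := by ring
      rw [this]
      exact add_mem (Ideal.mul_mem_left _ _ h₁) (Ideal.mul_mem_left _ _ h₂)

section Annihilator

open Polynomial

variable {D S : Type*} [CommRing D] [IsDomain D] [CommRing S] [Algebra D S]

/-- Pseudo-division: a power of the leading coefficient makes division with remainder possible. -/
theorem exists_leadingCoeff_pow_mul_eq {A : D[X]} (hA : A ≠ 0) (f : D[X]) :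
    ∃ (l : ℕ) (q g : D[X]), C A.leadingCoeff ^ l * f = A * q + g ∧ g.degree < A.degree := by
  induction hn : f.degree using WellFoundedLT.induction generalizing f with
  | ind n ih =>
    subst hn
    by_cases hlt : f.degree < A.degree
    · exact ⟨0, 0, f, by simp, hlt⟩
    by_cases hf : f = 0
    · exact ⟨0, 0, 0, by simp [hf], by simpa [bot_lt_iff_ne_bot] using hA⟩
    have hle : A.natDegree ≤ f.natDegree := natDegree_le_natDegree (not_lt.1 hlt)
    have hd : (C A.leadingCoeff * f -
        A * (C f.leadingCoeff * X ^ (f.natDegree - A.natDegree))).degree < f.degree := by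
      have h1 : (C A.leadingCoeff * f).degree = f.degree := by
        rw [degree_mul, degree_C (leadingCoeff_ne_zero.2 hA), zero_add]
      rw [← h1]
      refine degree_sub_lt_left ?_ ?_ ?_
      · rw [h1, degree_mul, degree_mul, degree_C (leadingCoeff_ne_zero.2 hf), degree_X_pow,
          degree_eq_natDegree hA, degree_eq_natDegree hf, zero_add]
        norm_cast
        omega
      · exact mul_ne_zero (C_ne_zero.2 (leadingCoeff_ne_zero.2 hA)) hf
      · simp only [leadingCoeff_mul, leadingCoeff_C, leadingCoeff_X_pow, mul_one]
    obtain ⟨l, q, g, h, hg⟩ := ih _ hd _ rfl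
    refine ⟨l + 1, q + C A.leadingCoeff ^ l * (C f.leadingCoeff * X ^ (f.natDegree - A.natDegree)),
      g, ?_, hg⟩
    linear_combination h

/-- A polynomial of least degree that annihilates `x` divides all the others up to powers of
its leading coefficient. -/
theorem exists_minimal_annihilator [CharZero D] [FaithfulSMul D S] {x : S}
    (hx : IsAlgebraic D x) :
    ∃ A : D[X], aeval x A = 0 ∧ aeval x (derivative A) ≠ 0 ∧ A.natDegree ≠ 0 ∧
      ∀ f : D[X], aeval x f = 0 → ∃ l, A ∣ C A.leadingCoeff ^ l * f := by
  obtain ⟨A, ⟨hA, hAx⟩, hmin⟩ := exists_minimalFor_of_wellFoundedLT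
    (fun f : D[X] => f ≠ 0 ∧ aeval x f = 0) degree hx
  have hlt : ∀ g : D[X], aeval x g = 0 → g.degree < A.degree → g = 0 := by
    intro g hg hd
    by_contra h
    exact (hmin ⟨h, hg⟩ hd.le).not_gt hd
  have hdeg : A.natDegree ≠ 0 := by
    intro h
    rw [eq_C_of_natDegree_eq_zero h, aeval_C, FaithfulSMul.algebraMap_eq_zero_iff] at hAx
    rw [eq_C_of_natDegree_eq_zero h, hAx, C_0] at hA
    exact hA rfl
  refine ⟨A, hAx, fun h => hdeg ?_, hdeg, fun f hf => ?_⟩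
  · exact derivative_eq_zero.1 (hlt _ h (degree_derivative_lt hA))
  · obtain ⟨l, q, g, h, hg⟩ := exists_leadingCoeff_pow_mul_eq hA f
    have h1 := congrArg (aeval x) h
    rw [map_mul, map_add, map_mul, hf, hAx, mul_zero, zero_mul, zero_add] at h1
    exact ⟨l, q, by rw [h, hlt g h1.symm hg, add_zero]⟩

/-- If `G` does not vanish at `x`, then the ideal generated by `A` and `G` contains a non-zero
constant: apply an annihilating polynomial of `G(x)` with non-zero constant coefficient to `G`. -/
theorem exists_C_eq_mul_add_mul [IsDomain S] [FaithfulSMul D S] {x : S} (hx : IsAlgebraic D x)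
    {A : D[X]} (hA : A ≠ 0) (hdvd : ∀ f : D[X], aeval x f = 0 → ∃ l, A ∣ C A.leadingCoeff ^ l * f)
    {G : D[X]} (hG : aeval x G ≠ 0) :
    ∃ (d : D) (q w : D[X]), d ≠ 0 ∧ C d = A * q + G * w := by
  have halg : IsAlgebraic D (aeval x G) := 
    Algebra.isAlgebraic_adjoin_singleton_iff.2 hx _ (aeval_mem_adjoin_singleton D x)
  obtain ⟨p, hp0, hp⟩ := halg.exists_nonzero_coeff_and_aeval_eq_zero
    (mem_nonZeroDivisors_of_ne_zero hG)
  obtain ⟨l, q, hq⟩ := hdvd (p.comp G) (by rw [aeval_comp, hp])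
  refine ⟨A.leadingCoeff ^ l * p.coeff 0, q, -(C A.leadingCoeff ^ l * p.divX.comp G),
    mul_ne_zero (pow_ne_zero _ (leadingCoeff_ne_zero.2 hA)) hp0, ?_⟩
  have h1 : p.comp G = p.divX.comp G * G + C (p.coeff 0) := by
    conv_lhs => rw [← p.divX_mul_X_add]
    simp
  rw [h1] at hq
  rw [C_mul, C_pow]
  linear_combination hq

end Annihilator

/-! ### Extension of homomorphisms to differentially finitely generated algebras -/

section OneIndeterminate

variable {R : Type*} [CommRing R]

theorem ord_lt_of_mem_orderLT {r : ℕ} {f : DiffPoly R (Fin 1)} (hf : f ∈ orderLT R 0 r) :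
    ord f < r := by
  refine (Finset.sup_lt_iff (WithBot.bot_lt_coe r)).2 fun v hv => ?_
  obtain ⟨j, k⟩ := v
  obtain rfl : j = 0 := Subsingleton.elim _ _
  exact WithBot.coe_lt_coe.2 (mem_orderLT_iff.1 hf k hv)

theorem le_ord_of_mem_vars {r : ℕ} {f : DiffPoly R (Fin 1)} (h : ((0 : Fin 1), r) ∈ f.vars) :
    (r : WithBot ℕ) ≤ ord f :=
  Finset.le_sup (f := fun v : Fin 1 × ℕ => (v.2 : WithBot ℕ)) h

theorem eq_C_of_mem_orderLT_zero {f : DiffPoly R (Fin 1)} (hf : f ∈ orderLT R 0 0) :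
    ∃ c, f = MvPolynomial.C c := by
  refine ⟨_, MvPolynomial.vars_eq_empty_iff_eq_C.1 (Finset.eq_empty_of_forall_notMem ?_)⟩
  rintro ⟨j, k⟩ h
  obtain rfl : j = 0 := Subsingleton.elim _ _
  exact absurd (mem_orderLT_iff.1 hf k h) (Nat.not_lt_zero k)

theorem exists_mem_orderLT (f : DiffPoly R (Fin 1)) : ∃ m, f ∈ orderLT R 0 m := by
  refine ⟨f.vars.sup Prod.snd + 1, mem_orderLT_iff.2 fun k hk => ?_⟩
  exact Nat.lt_succ_of_le (Finset.le_sup (f := Prod.snd) hk)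

/-- A differential polynomial of order at most `r` as a polynomial in `y^(r)`. -/
theorem exists_aeval_X_eq {r : ℕ} {f : DiffPoly R (Fin 1)} (hf : f ∈ orderLT R 0 (r + 1)) :
    ∃ p : Polynomial (orderLT R (0 : Fin 1) r),
      Polynomial.aeval (MvPolynomial.X (0, r) : DiffPoly R (Fin 1)) p = f := by
  refine orderLT_induction (p := fun f => ∃ p : Polynomial (orderLT R (0 : Fin 1) r),
      Polynomial.aeval (MvPolynomial.X (0, r) : DiffPoly R (Fin 1)) p = f)
    (fun a => ⟨Polynomial.C ⟨MvPolynomial.C a, Subalgebra.algebraMap_mem _ _⟩, by simp⟩)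
    (fun j k h => ?_) ?_ ?_ hf
  · obtain rfl : j = 0 := Subsingleton.elim _ _
    rcases Nat.lt_succ_iff_lt_or_eq.1 (h rfl) with hk | rfl
    · exact ⟨Polynomial.C ⟨_, X_mem_orderLT fun _ => hk⟩, Polynomial.aeval_C _ _⟩
    · exact ⟨Polynomial.X, by simp⟩
  · rintro f g - - ⟨p, rfl⟩ ⟨q, rfl⟩
    exact ⟨p + q, by simp⟩
  · rintro f g - - ⟨p, rfl⟩ ⟨q, rfl⟩
    exact ⟨p * q, by simp⟩

theorem aeval_X_mem_orderLT {r : ℕ} (p : Polynomial (orderLT R (0 : Fin 1) r)) :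
    Polynomial.aeval (MvPolynomial.X (0, r) : DiffPoly R (Fin 1)) p ∈ orderLT R 0 (r + 1) := by
  rw [Polynomial.aeval_eq_sum_range]
  refine sum_mem fun k _ => ?_
  rw [Algebra.smul_def]
  exact mul_mem (orderLT_mono r.le_succ (p.coeff k).2)
    (pow_mem (X_mem_orderLT fun _ => r.lt_succ_self) _)

theorem pderiv_aeval_X {r : ℕ} (p : Polynomial (orderLT R (0 : Fin 1) r)) :
    MvPolynomial.pderiv (0, r)
        (Polynomial.aeval (MvPolynomial.X (0, r) : DiffPoly R (Fin 1)) p) =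
      Polynomial.aeval (MvPolynomial.X (0, r) : DiffPoly R (Fin 1)) p.derivative := by
  induction p using Polynomial.induction_on' with
  | add p q hp hq => simp only [map_add, hp, hq]
  | monomial n c =>
    have hc : MvPolynomial.pderiv (0, r) (algebraMap _ (DiffPoly R (Fin 1)) c) = 0 :=
      pderiv_eq_zero_of_mem_orderLT c.2
    simp only [Polynomial.aeval_monomial, Polynomial.derivative_monomial, MvPolynomial.pderiv_mul,
      MvPolynomial.pderiv_pow, MvPolynomial.pderiv_X_self, hc, map_mul, map_natCast]
    ring

/-- `y^(r)` occurs in a polynomial in `y^(r)` of positive degree, also after a change of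
coefficients that does not kill the leading coefficient. -/
theorem mem_vars_map_aeval_X {F : Type*} [Field F] [CharZero F] (φ : R →+* F) {r : ℕ}
    {p : Polynomial (orderLT R (0 : Fin 1) r)} (hdeg : p.natDegree ≠ 0)
    (hlead : MvPolynomial.map φ (p.leadingCoeff : DiffPoly R (Fin 1)) ≠ 0) :
    ((0 : Fin 1), r) ∈ (MvPolynomial.map φ
      (Polynomial.aeval (MvPolynomial.X (0, r) : DiffPoly R (Fin 1)) p)).vars := by
  by_contra hvars
  have h0 := MvPolynomial.pderiv_eq_zero_of_notMem_vars hvars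
  rw [MvPolynomial.pderiv_map, pderiv_aeval_X] at h0
  -- the highest iterated derivative is a multiple of the leading coefficient
  have h1 : ∀ n, MvPolynomial.map φ (Polynomial.aeval (MvPolynomial.X (0, r) :
      DiffPoly R (Fin 1)) (Polynomial.derivative^[n + 1] p)) = 0 := by
    intro n
    induction n with
    | zero => exact h0
    | succ n ih =>
      rw [Function.iterate_succ_apply', ← pderiv_aeval_X, ← MvPolynomial.pderiv_map, ih, map_zero]
  obtain ⟨n, hn⟩ := Nat.exists_eq_succ_of_ne_zero hdeg
  have h2 := h1 n
  have h3 : Polynomial.derivative^[n + 1] p =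
      Polynomial.C (((n + 1).factorial : orderLT R (0 : Fin 1) r) * p.leadingCoeff) := by
    rw [Polynomial.eq_C_of_natDegree_eq_zero (p := Polynomial.derivative^[n + 1] p)
      (Nat.le_zero.1 ((Polynomial.natDegree_iterate_derivative p (n + 1)).trans (by omega))),
      Polynomial.coeff_iterate_derivative, Polynomial.leadingCoeff, hn, zero_add,
      Nat.descFactorial_self, nsmul_eq_mul]
  rw [h3, Polynomial.aeval_C, map_mul, map_mul, map_natCast, map_natCast] at h2
  exact (mul_ne_zero (Nat.cast_ne_zero.2 (Nat.factorial_ne_zero _)) hlead) h2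

end OneIndeterminate

variable {F : Type u} [Field F] [CharZero F] [Differential F]

/-- The extension property for an algebra `S` generated over `R` by one element `x` and its
derivatives.

If `x` is differentially transcendental over `R`, any point of `F` off a given non-zero
differential polynomial will do.  Otherwise let `r` be the least order of a differential polynomial
that annihilates `x`, and `A` such a polynomial of order `r` and least degree in `y^(r)`.  A point
at which `A` vanishes but neither the separant nor the initial of `A` does defines a homomorphism
on `S`, since `A` determines the kernel of `R{y} → S` up to powers of separant and initial.  An
element `d` of order less than `r` in the ideal of `A` and the elements to be avoided turns the
problem into an instance of Blum's axiom. -/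
theorem IsDifferentiallyClosed.exists_extension_of_surjective (hF : IsDifferentiallyClosed F)
    {R S : Type*} [CommRing R] [IsDomain R] [Differential R] [CommRing S] [IsDomain S] [CharZero S]
    [Differential S] (ι : R →+* S) (hι : Function.Injective ι) (hι' : ∀ a, ι (a′) = (ι a)′)
    (x : S) (hx : Function.Surjective (evalHom ι fun _ : Fin 1 => x)) {b : S} (hb : b ≠ 0) :
    ∃ a : R, a ≠ 0 ∧ ∀ φ : R →+* F, (∀ a, φ (a′) = (φ a)′) → φ a ≠ 0 →
      ∃ ψ : S →+* F, (∀ s, ψ (s′) = (ψ s)′) ∧ (∀ a, ψ (ι a) = φ a) ∧ ψ b ≠ 0 := by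
  set E := evalHom ι fun _ : Fin 1 => x with hE
  have hE' : ∀ f, E (f′) = (E f)′ := evalHom_deriv ι hι' _
  obtain ⟨b', rfl⟩ := hx b
  have hb' : b' ≠ 0 := by rintro rfl; exact hb (map_zero E)
  -- it suffices to find the image of `x`
  suffices h : ∃ c : DiffPoly R (Fin 1), c ≠ 0 ∧ ∀ φ : R →+* F, (∀ a, φ (a′) = (φ a)′) →
      MvPolynomial.map φ c ≠ 0 → ∃ α : F, (∀ f, E f = 0 → evalHom φ (fun _ => α) f = 0) ∧
        evalHom φ (fun _ => α) b' ≠ 0 by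
    obtain ⟨c, hc, h⟩ := h
    obtain ⟨m, hm⟩ := MvPolynomial.ne_zero_iff.1 hc
    refine ⟨c.coeff m, hm, fun φ hφ hφm => ?_⟩
    obtain ⟨α, hker, hα⟩ := h φ hφ (MvPolynomial.ne_zero_iff.2 ⟨m, by
      rwa [MvPolynomial.coeff_map]⟩)
    have hlift : ∀ f, E.liftOfSurjective hx ⟨evalHom φ fun _ => α, fun f hf => hker f hf⟩ (E f) =
        evalHom φ (fun _ => α) f := E.liftOfSurjective_comp_apply hx _
    refine ⟨E.liftOfSurjective hx ⟨evalHom φ fun _ => α, fun f hf => hker f hf⟩, fun s => ?_,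
      fun a => ?_, by rwa [hlift]⟩
    · obtain ⟨f, rfl⟩ := hx s
      rw [← hE', hlift, hlift, evalHom_deriv φ hφ]
    · rw [← evalHom_C ι (fun _ : Fin 1 => x) a, ← hE, hlift, evalHom_C]
  by_cases hker : ∀ f, E f = 0 → f = 0
  · refine ⟨b', hb', fun φ _ hφb => ?_⟩
    obtain ⟨m, hm⟩ := exists_mem_orderLT (MvPolynomial.map φ b')
    obtain ⟨α, -, hα⟩ := hF (MvPolynomial.X (0, m)) (MvPolynomial.map φ b') hφb
      ((ord_lt_of_mem_orderLT hm).trans_le (le_ord_of_mem_vars (by simp)))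
    refine ⟨α, fun f hf => by rw [hker f hf, map_zero], ?_⟩
    rwa [evalHom_eq_evalAt_map]
  · push Not at hker
    have hex : ∃ m, ∃ f ∈ orderLT R (0 : Fin 1) m, E f = 0 ∧ f ≠ 0 := by
      obtain ⟨f, hf⟩ := hker
      obtain ⟨m, hm⟩ := exists_mem_orderLT f
      exact ⟨m, f, hm, hf⟩
    classical
    obtain ⟨r, hr⟩ : ∃ r, Nat.find hex = r + 1 := by
      refine Nat.exists_eq_succ_of_ne_zero fun h0 => ?_
      obtain ⟨f, hf, hEf, hf0⟩ := Nat.find_spec hex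
      rw [h0] at hf
      obtain ⟨c, rfl⟩ := eq_C_of_mem_orderLT_zero hf
      rw [hE, evalHom_C, map_eq_zero_iff ι hι] at hEf
      exact hf0 (by rw [hEf, map_zero])
    let D := orderLT R (0 : Fin 1) r
    let _ : Algebra D S := (E.comp D.val.toRingHom).toAlgebra
    have hDS : ∀ d : D, algebraMap D S d = E (d : DiffPoly R (Fin 1)) := fun _ => rfl
    have hinj : Function.Injective (algebraMap D S) := by
      refine (injective_iff_map_eq_zero _).2 fun d hd => ?_
      by_contra hd0
      exact Nat.find_min hex (m := r) (by omega) ⟨d, d.2, hd, fun h => hd0 (Subtype.ext h)⟩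
    have : FaithfulSMul D S := (faithfulSMul_iff_algebraMap_injective D S).2 hinj
    have : CharZero D := (algebraMap D S).charZero
    let Y : DiffPoly R (Fin 1) := MvPolynomial.X (0, r)
    have hEY : ∀ p : Polynomial D, E (Polynomial.aeval Y p) = Polynomial.aeval (E Y) p := by
      intro p
      rw [Polynomial.aeval_def, Polynomial.aeval_def, Polynomial.hom_eval₂]
      rfl
    have halg : IsAlgebraic D (E Y) := by
      obtain ⟨f, hf, hEf, hf0⟩ := Nat.find_spec hex
      rw [hr] at hf
      obtain ⟨p, rfl⟩ := exists_aeval_X_eq hf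
      exact ⟨p, fun h => hf0 (by rw [h, map_zero]), by rw [← hEY, hEf]⟩
    obtain ⟨A, hAx, hSx, hdeg, hdvd⟩ := exists_minimal_annihilator halg
    have hA : A ≠ 0 := by rintro rfl; exact hdeg Polynomial.natDegree_zero
    set P : DiffPoly R (Fin 1) := Polynomial.aeval Y A with hP
    have hPmem : P ∈ orderLT R 0 (r + 1) := aeval_X_mem_orderLT A
    have hPsep : MvPolynomial.pderiv (0, r) P = Polynomial.aeval Y A.derivative :=
      pderiv_aeval_X A
    set I := Ideal.span (Set.range fun s => (fun z : DiffPoly R (Fin 1) => z′)^[s] P) with hI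
    have hIE : ∀ f ∈ I, E f = 0 := fun f =>
      map_eq_zero_of_mem_span_iterate hE' (by rw [hP, hEY, hAx])
    obtain ⟨k, b₁, hb₁, hkb⟩ := exists_separant_pow_mul_sub_mem hPmem b'
    obtain ⟨p, rfl⟩ := exists_aeval_X_eq hb₁
    have hEp : Polynomial.aeval (E Y) p ≠ 0 := by
      have := hIE _ hkb
      rw [map_sub, map_mul, map_pow, hPsep, hEY, hEY, sub_eq_zero] at this
      rw [← this]
      exact mul_ne_zero (pow_ne_zero _ hSx) hb
    obtain ⟨d, q, w, hd, hdqw⟩ := exists_C_eq_mul_add_mul halg hA hdvd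
      (G := p * A.derivative * Polynomial.C A.leadingCoeff) (by
        rw [map_mul, map_mul, Polynomial.aeval_C]
        refine mul_ne_zero (mul_ne_zero hEp hSx) ?_
        rw [map_ne_zero_iff _ hinj]
        exact Polynomial.leadingCoeff_ne_zero.2 hA)
    have hdA : (d : DiffPoly R (Fin 1)) * (A.leadingCoeff : DiffPoly R (Fin 1)) ≠ 0 := by
      rw [← Subalgebra.coe_mul]
      exact fun h => mul_ne_zero hd (Polynomial.leadingCoeff_ne_zero.2 hA) (Subtype.ext h)
    refine ⟨_, hdA, fun φ hφ hφd => ?_⟩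
    rw [map_mul] at hφd
    obtain ⟨α, hα, hdα⟩ := hF (MvPolynomial.map φ P) (MvPolynomial.map φ d)
      (left_ne_zero_of_mul hφd)
      ((ord_lt_of_mem_orderLT (mem_orderLT_iff.2 fun k hk =>
          mem_orderLT_iff.1 d.2 k (MvPolynomial.vars_map _ _ hk))).trans_le
        (le_ord_of_mem_vars (mem_vars_map_aeval_X φ hdeg (right_ne_zero_of_mul hφd))))
    rw [← evalHom_eq_evalAt_map] at hα hdα
    set H := evalHom φ fun _ : Fin 1 => α with hH
    have hIH : ∀ f ∈ I, H f = 0 := fun f =>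
      map_eq_zero_of_mem_span_iterate (evalHom_deriv φ hφ _) hα
    have hHG : H (Polynomial.aeval Y (p * A.derivative * Polynomial.C A.leadingCoeff)) ≠ 0 := by
      have h := congrArg (fun g => H (Polynomial.aeval Y g)) hdqw
      simp only [map_add, map_mul, ← hP, hα, zero_mul, zero_add, Polynomial.aeval_C] at h
      intro h0
      simp only [map_mul, Polynomial.aeval_C] at h0
      rw [h0, zero_mul] at h
      exact hdα h
    rw [map_mul, map_mul, map_mul, map_mul, Polynomial.aeval_C] at hHG
    have hHA := right_ne_zero_of_mul hHG
    have hHS := right_ne_zero_of_mul (left_ne_zero_of_mul hHG)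
    have hHp := left_ne_zero_of_mul (left_ne_zero_of_mul hHG)
    refine ⟨α, fun f hf => ?_, fun h0 => ?_⟩
    · obtain ⟨k, g, hg, hkg⟩ := exists_separant_pow_mul_sub_mem hPmem f
      obtain ⟨t, rfl⟩ := exists_aeval_X_eq hg
      have h1 := hIE _ hkg
      rw [map_sub, map_mul, hf, mul_zero, zero_sub, neg_eq_zero, hEY] at h1
      obtain ⟨l, c, hc⟩ := hdvd t h1
      have h2 := congrArg (fun g => H (Polynomial.aeval Y g)) hc
      simp only [map_mul, map_pow, ← hP, hα, zero_mul, Polynomial.aeval_C] at h2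
      have h3 := hIH _ hkg
      rw [map_sub, map_mul, map_pow, hPsep,
        (mul_eq_zero.1 h2).resolve_left (pow_ne_zero _ hHA), sub_zero] at h3
      exact (mul_eq_zero.1 h3).resolve_left (pow_ne_zero _ hHS)
    · have h3 := hIH _ hkb
      rw [map_sub, map_mul, h0, mul_zero, zero_sub, neg_eq_zero] at h3
      exact hHp h3

/-- The derivation of a subring that is stable under the derivation. -/
abbrev subringDifferential {S : Type*} [CommRing S] [Differential S] (U : Subring S)
    (hU : ∀ s ∈ U, s′ ∈ U) : Differential U :=
  ⟨Derivation.mk' ({ toFun := fun s => ⟨(s : S)′, hU s s.2⟩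
                     map_zero' := Subtype.ext (by simp)
                     map_add' := fun s t => Subtype.ext (by simp) } : U →+ U).toIntLinearMap
    fun s t => Subtype.ext (by simp)⟩

/-- The extension property for finitely many generators.  That `S` is generated by `R` and the
derivatives of the `x_i` is expressed by saying that no proper subring contains all of them. -/
theorem IsDifferentiallyClosed.exists_extension (hF : IsDifferentiallyClosed F) (n : ℕ) :
    ∀ {R S : Type w} [CommRing R] [IsDomain R] [Differential R] [CommRing S] [IsDomain S]
      [CharZero S] [Differential S] (ι : R →+* S) (_ : Function.Injective ι)
      (_ : ∀ a, ι (a′) = (ι a)′) (x : Fin n → S) (_ : ∀ U : Subring S, (∀ a, ι a ∈ U) →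
        (∀ i k, (fun z : S => z′)^[k] (x i) ∈ U) → U = ⊤) {b : S} (_ : b ≠ 0),
    ∃ a : R, a ≠ 0 ∧ ∀ φ : R →+* F, (∀ a, φ (a′) = (φ a)′) → φ a ≠ 0 →
      ∃ ψ : S →+* F, (∀ s, ψ (s′) = (ψ s)′) ∧ (∀ a, ψ (ι a) = φ a) ∧ ψ b ≠ 0 := by
  induction n with
  | zero =>
    intro R S _ _ _ _ _ _ _ ι hι hι' x hx b hb
    have hsurj : Function.Surjective ι := RingHom.range_eq_top.1 <|
      hx ι.range (fun a => ⟨a, rfl⟩) fun i => i.elim0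
    let e := RingEquiv.ofBijective ι ⟨hι, hsurj⟩
    have he : ∀ a, e.symm (ι a) = a := fun a => e.symm_apply_apply a
    obtain ⟨a, rfl⟩ := hsurj b
    refine ⟨a, fun h => hb (by rw [h, map_zero]), fun φ hφ hφa => ⟨φ.comp e.symm.toRingHom,
      fun s => ?_, fun a => by simp [he], by simpa [he] using hφa⟩⟩
    obtain ⟨s, rfl⟩ := hsurj s
    simp [← hι', he, hφ]
  | succ n ih =>
    intro R S _ _ _ _ _ _ _ ι hι hι' x hx b hb
    let E : DiffPoly R (Fin 1) →+* S := evalHom ι fun _ => x 0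
    have hE' : ∀ f, E (f′) = (E f)′ := evalHom_deriv ι hι' _
    let U := E.range
    have hU : ∀ s ∈ U, s′ ∈ U := by
      rintro _ ⟨f, rfl⟩
      exact ⟨f′, hE' f⟩
    let _ : Differential U := subringDifferential U hU
    have hUd : ∀ s : U, ((s′ : U) : S) = (s : S)′ := fun _ => rfl
    obtain ⟨a', ha', h'⟩ := ih U.subtype Subtype.val_injective hUd (fun i => x i.succ)
      (fun V hUV hV => hx V (fun a => hUV ⟨ι a, MvPolynomial.C a, evalHom_C ..⟩) fun i k => by
        refine Fin.cases ?_ (fun i => hV i k) i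
        exact hUV ⟨_, MvPolynomial.X (0, k), evalHom_X ..⟩) hb
    let ι' : R →+* U := ι.codRestrict U fun a => ⟨MvPolynomial.C a, evalHom_C ..⟩
    have hι'' : ∀ a, (ι' a : S) = ι a := fun _ => rfl
    have hx0 : ((⟨x 0, MvPolynomial.X (0, 0), evalHom_X ..⟩ : U) : S) = x 0 := rfl
    have hEU : ∀ f, E.rangeRestrict f = evalHom ι'
        (fun _ => (⟨x 0, MvPolynomial.X (0, 0), evalHom_X ..⟩ : U)) f := by
      intro f
      refine (eq_evalHom E.rangeRestrict (fun f => Subtype.ext (hE' f)) f).trans ?_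
      congr 2
      · ext a; simp [E, hι'']
      · ext i; simp [E, Subsingleton.elim i 0]
    obtain ⟨a, ha, h⟩ := hF.exists_extension_of_surjective ι'
      (fun s t hst => hι (congrArg Subtype.val hst)) (fun s => Subtype.ext (hι' s)) _
      (fun s => by
        obtain ⟨f, rfl⟩ := E.rangeRestrict_surjective s
        exact ⟨f, (hEU f).symm⟩) ha'
    refine ⟨a, ha, fun φ hφ hφa => ?_⟩
    obtain ⟨ψ', hψ', hψφ, hψa⟩ := h φ hφ hφa
    obtain ⟨ψ, hψ, hψψ', hψb⟩ := h' ψ' hψ' hψa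
    exact ⟨ψ, hψ, fun a => by rw [← hψφ, ← hψψ']; rfl, hψb⟩

theorem IsDifferentiallyClosed.chevalleyExtension (hF : IsDifferentiallyClosed F) :
    ChevalleyExtension.{u, v} F := by
  intro S _ _ _ _ R hR b hfg hb
  obtain ⟨n, x, hx⟩ := hfg
  let _ : Differential R := subringDifferential R.toSubring hR
  have : CharZero S := algebraRat.charZero S
  obtain ⟨a, ha, h⟩ := hF.exists_extension n (R.val : R →+* S) Subtype.val_injective
    (fun _ => rfl) x (fun U hRU hU => by
      refine eq_top_iff.2 fun s _ => ?_
      have hs : s ∈ Algebra.adjoin R {s : S | ∃ (i : Fin n) (k : ℕ),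
        s = (fun z : S => z′)^[k] (x i)} := hx ▸ Algebra.mem_top
      refine Algebra.adjoin_induction (p := fun s _ => s ∈ U) ?_ (fun r => hRU r)
        (fun _ _ _ _ => add_mem) (fun _ _ _ _ => mul_mem) hs
      rintro _ ⟨i, k, rfl⟩
      exact hU i k) hb
  refine ⟨a, ha, fun φ hφ hφa => ?_⟩
  obtain ⟨ψ, hψ, hψφ, hψb⟩ := h φ.toRingHom hφ hφa
  exact ⟨ψ.toRatAlgHom, hψ, hψφ, hψb⟩

/-! ### Irreducible factors and separants -/

section Factors

variable {F τ : Type*} [Field F]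

theorem vars_subset_of_dvd {p f : MvPolynomial τ F} (hf : f ≠ 0) (h : p ∣ f) :
    p.vars ⊆ f.vars := by
  obtain ⟨q, rfl⟩ := h
  intro v hv
  rw [MvPolynomial.mem_vars_iff_degreeOf_ne_zero] at hv ⊢
  rw [MvPolynomial.degreeOf_mul_eq (left_ne_zero_of_mul hf) (right_ne_zero_of_mul hf)]
  omega

theorem exists_irreducible_dvd_mem_vars {v : τ} {f : MvPolynomial τ F} (hv : v ∈ f.vars) :
    ∃ p, Irreducible p ∧ p ∣ f ∧ v ∈ p.vars := by
  classical
  induction f using WfDvdMonoid.induction_on_irreducible with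
  | zero => simp at hv
  | unit a ha =>
    obtain ⟨c, -, rfl⟩ := MvPolynomial.isUnit_iff_eq_C_of_isReduced.1 ha
    simp at hv
  | mul a p _ hp ih =>
    rcases Finset.mem_union.1 (MvPolynomial.vars_mul p a hv) with h | h
    · exact ⟨p, hp, dvd_mul_right _ _, h⟩
    · obtain ⟨q, hq, hqa, hvq⟩ := ih h
      exact ⟨q, hq, hqa.mul_left p, hvq⟩

theorem not_dvd_pderiv [CharZero F] {v : τ} {f : MvPolynomial τ F} (hv : v ∈ f.vars) :
    ¬ f ∣ MvPolynomial.pderiv v f := by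
  have hdeg := Nat.pos_of_ne_zero (MvPolynomial.mem_vars_iff_degreeOf_ne_zero.1 hv)
  have hlt : (MvPolynomial.pderiv v f).degreeOf v < f.degreeOf v := by
    refine (MvPolynomial.degreeOf_lt_iff hdeg).2 fun m hm => ?_
    rw [MvPolynomial.mem_support_iff, MvPolynomial.coeff_pderiv] at hm
    have := MvPolynomial.monomial_le_degreeOf v
      (MvPolynomial.mem_support_iff.2 (left_ne_zero_of_mul hm))
    simp only [Finsupp.add_apply, Finsupp.single_eq_same] at this
    omega
  have hne : MvPolynomial.pderiv v f ≠ 0 := by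
    obtain ⟨m, hm, hvm⟩ := (MvPolynomial.mem_vars_iff_mem_support v).1 hv
    refine MvPolynomial.ne_zero_iff.2 ⟨m - Finsupp.single v 1, ?_⟩
    rw [MvPolynomial.coeff_pderiv, tsub_add_cancel_of_le (Finsupp.single_le_iff.2
      (Nat.one_le_iff_ne_zero.2 (Finsupp.mem_support_iff.1 hvm)))]
    exact mul_ne_zero (MvPolynomial.mem_support_iff.1 hm) (Nat.cast_add_one_ne_zero _)
  rintro ⟨q, hq⟩
  rw [hq] at hne
  rw [hq, MvPolynomial.degreeOf_mul_eq (left_ne_zero_of_mul hne) (right_ne_zero_of_mul hne)] at hlt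
  omega

end Factors

section OneIndeterminate

variable {F : Type u} [Field F]

theorem exists_mem_vars_of_bot_lt_ord {f : DiffPoly F (Fin 1)} (h : ⊥ < ord f) :
    ∃ r : ℕ, ord f = r ∧ ((0 : Fin 1), r) ∈ f.vars := by
  have hne : f.vars.Nonempty := by
    rw [Finset.nonempty_iff_ne_empty]
    intro h0
    rw [ord, h0, Finset.sup_empty] at h
    exact lt_irrefl _ h
  obtain ⟨⟨j, r⟩, hv, hr⟩ := Finset.exists_mem_eq_sup _ hne
    (fun v : Fin 1 × ℕ => (v.2 : WithBot ℕ))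
  obtain rfl : j = 0 := Subsingleton.elim _ _
  exact ⟨r, hr, hv⟩

theorem mem_orderLT_of_ord_le {r : ℕ} {f : DiffPoly F (Fin 1)} (h : ord f ≤ r) :
    f ∈ orderLT F 0 (r + 1) :=
  mem_orderLT_iff.2 fun _ hk => Nat.lt_succ_of_le (WithBot.coe_le_coe.1
    ((le_ord_of_mem_vars hk).trans h))

theorem bot_lt_ord_of_irreducible {A : DiffPoly F (Fin 1)} (hA : Irreducible A) : ⊥ < ord A := by
  by_contra h
  have hv : A.vars = ∅ := Finset.eq_empty_of_forall_notMem fun v hv => h <|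
    (WithBot.bot_lt_coe v.2).trans_le
      (Finset.le_sup (f := fun v : Fin 1 × ℕ => (v.2 : WithBot ℕ)) hv)
  have hC := MvPolynomial.vars_eq_empty_iff_eq_C.1 hv
  have h0 : A.coeff 0 ≠ 0 := fun h0 => hA.ne_zero (by rw [hC, h0, map_zero])
  exact hA.not_isUnit (by rw [hC]; exact (IsUnit.mk0 _ h0).map MvPolynomial.C)

variable [CharZero F] [Differential F]

/-- An irreducible `A` has a generic zero in the fraction field of `F{y} / (A)`, at which neither
the separant nor any polynomial of order at most `ord A` outside `(A)` vanishes. -/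
theorem notMem_radical_span_iterate {A G : DiffPoly F (Fin 1)} (hA : Irreducible A)
    (hG : ord G ≤ ord A) (hAG : ¬ A ∣ G) :
    separant A * G ∉ (Ideal.span (Set.range fun s =>
      (fun z : DiffPoly F (Fin 1) => z′)^[s] A)).radical := by
  obtain ⟨r, hr, hv⟩ := exists_mem_vars_of_bot_lt_ord (bot_lt_ord_of_irreducible hA)
  have hsep : separant A = MvPolynomial.pderiv (0, r) A := by rw [separant, hr]; rfl
  have hp : (Ideal.span {A}).IsPrime :=
    (Ideal.span_singleton_prime hA.ne_zero).2 hA.prime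
  let Q := DiffPoly F (Fin 1) ⧸ Ideal.span {A}
  let θ₀ : DiffPoly F (Fin 1) →+* FractionRing Q :=
    (algebraMap Q (FractionRing Q)).comp (Ideal.Quotient.mk _)
  have hθ₀ : ∀ f, θ₀ f = 0 ↔ A ∣ f := by
    intro f
    rw [RingHom.comp_apply, map_eq_zero_iff _ (IsFractionRing.injective Q (FractionRing Q)),
      Ideal.Quotient.eq_zero_iff_mem, Ideal.mem_span_singleton]
  have hAr := mem_orderLT_of_ord_le hr.le
  have hS : θ₀ (MvPolynomial.pderiv (0, r) A) ≠ 0 := fun h => not_dvd_pderiv hv ((hθ₀ _).1 h)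
  obtain ⟨θ, hθ, hθA⟩ :=
    exists_ringHom_iterate_deriv_eq_zero hAr θ₀ ((hθ₀ A).2 dvd_rfl) hS
  rintro ⟨n, hn⟩
  have h1 : θ ((separant A * G) ^ n) = 0 := by
    refine (Ideal.span_le (I := RingHom.ker θ)).2 ?_ hn
    rintro _ ⟨s, rfl⟩
    exact hθA s
  rw [map_pow, map_mul, hsep, hθ _ (pderiv_mem_orderLT hAr _),
    hθ _ (mem_orderLT_of_ord_le (hG.trans hr.le))] at h1
  exact pow_ne_zero n (mul_ne_zero hS fun h => hAG ((hθ₀ G).1 h)) h1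

end OneIndeterminate

/-! ### Points of differential ideals -/

section Points

variable {F : Type u} [Field F] [Differential F]

/-- Chevalley's extension property applied to `F ⊆ F{y_1, …, y_n} / J`. -/
theorem ChevalleyExtension.exists_point [CharZero F] (hF : ChevalleyExtension.{u, v} F) {n : ℕ}
    {J : Ideal (DiffPoly F (Fin n))} (hJ : IsDifferentialIdeal J) (hp : J.IsPrime)
    {B : DiffPoly F (Fin n)} (hB : B ∉ J) :
    ∃ α : Fin n → F, (∀ f ∈ J, evalAt α f = 0) ∧ evalAt α B ≠ 0 := by
  let Q := DiffPoly F (Fin n) ⧸ J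
  let S := ULift.{v} Q
  let e : Q ≃+* S := ULift.ringEquiv.symm
  have : IsDomain S := e.symm.toMulEquiv.isDomain Q
  let π : DiffPoly F (Fin n) →+* S := (e : Q →+* S).comp (Ideal.Quotient.mk J)
  have hπs : Function.Surjective π := e.surjective.comp Ideal.Quotient.mk_surjective
  have hπ : ∀ f, π f = 0 ↔ f ∈ J := fun f => by
    rw [← Ideal.Quotient.eq_zero_iff_mem]
    exact map_eq_zero_iff _ e.injective
  have hker : ∀ f, π.toIntAlgHom f = 0 → π.toIntAlgHom (f′) = 0 :=
    fun f hf => (hπ _).2 (hJ f ((hπ f).1 hf))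
  let _ : Differential S := ⟨Derivation.liftOfSurjective (f := π.toIntAlgHom) hπs hker⟩
  have hπd : ∀ f, π (f′) = (π f)′ := fun f =>
    (Derivation.liftOfSurjective_apply (f := π.toIntAlgHom) hπs hker f).symm
  let ι : F →ₐ[ℚ] S := (π.comp MvPolynomial.C).toRatAlgHom
  have hι : ∀ a, ι a = π (MvPolynomial.C a) := fun _ => rfl
  have hιd : ∀ a, ι (a′) = (ι a)′ := fun a => by rw [hι, hι, ← hπd, DiffPoly.deriv_C]
  have hιinj : Function.Injective ι := ι.toRingHom.injective
  have hR : ∀ x ∈ ι.range, x′ ∈ ι.range := by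
    rintro _ ⟨a, rfl⟩
    exact ⟨a′, hιd a⟩
  have hX : ∀ (i : Fin n) (k : ℕ), π (MvPolynomial.X (i, k)) =
      (fun z : S => z′)^[k] (π (MvPolynomial.X (i, 0))) := fun i k => by
    rw [← map_iterate_deriv π hπd, iterate_deriv_X, zero_add]
  have hfg : IsDifferentiallyFG ι.range := by
    refine ⟨n, fun i => π (MvPolynomial.X (i, 0)), ?_⟩
    rw [eq_top_iff]
    rintro s -
    obtain ⟨f, rfl⟩ := hπs s
    induction f using MvPolynomial.induction_on with
    | C a => exact Subalgebra.algebraMap_mem _ (⟨ι a, a, rfl⟩ : ι.range)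
    | add p q hp hq => rw [map_add]; exact add_mem hp hq
    | mul_X p w hp =>
      rw [map_mul]
      exact mul_mem hp (Algebra.subset_adjoin ⟨w.1, w.2, hX w.1 w.2⟩)
  obtain ⟨a, ha, h⟩ := hF S ι.range hR (π B) hfg (fun h => hB ((hπ B).1 h))
  let ε := AlgEquiv.ofInjective ι hιinj
  have hε : ∀ a, ε.symm ⟨ι a, a, rfl⟩ = a := fun a => ε.symm_apply_apply a
  obtain ⟨ψ, hψ, hψι, hψB⟩ := h ε.symm.toAlgHom (by
    rintro ⟨_, b, rfl⟩
    have : (⟨(ι b)′, hR _ ⟨b, rfl⟩⟩ : ι.range) = ⟨ι (b′), b′, rfl⟩ := Subtype.ext (hιd b).symm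
    exact (congrArg ε.symm this).trans ((hε _).trans (congrArg _ (hε b).symm)))
    ((map_ne_zero_iff _ ε.symm.injective).2 ha)
  have hψ' : ∀ f, ψ (π f) = evalAt (fun i => ψ (π (MvPolynomial.X (i, 0)))) f := by
    intro f
    refine (eq_evalHom ((ψ : S →+* F).comp π) (fun f => ?_) f).trans ?_
    · rw [RingHom.comp_apply, hπd]; exact hψ _
    · rw [evalAt_eq_evalHom]
      congr 2
      ext b
      exact (hψι ⟨ι b, b, rfl⟩).trans (hε b)
  refine ⟨fun i => ψ (π (MvPolynomial.X (i, 0))), fun f hf => ?_, by rwa [← hψ']⟩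
  rw [← hψ', (hπ f).2 hf, map_zero]

/-- Rabinowitsch's trick: a point of the ideal generated by `J` and `B z - 1`, with `z` a new
indeterminate, is a point of `J` at which `B` does not vanish. -/
theorem exists_point_of_forall_proper {n : ℕ}
    (h : ∀ J : Ideal (DiffPoly F (Fin (n + 1))), IsDifferentialIdeal J → J ≠ ⊤ →
      ∃ α : Fin (n + 1) → F, ∀ f ∈ J, evalAt α f = 0)
    {J : Ideal (DiffPoly F (Fin n))} (hJ : IsDifferentialIdeal J) (hp : J.IsRadical)
    {B : DiffPoly F (Fin n)} (hB : B ∉ J) :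
    ∃ α : Fin n → F, (∀ f ∈ J, evalAt α f = 0) ∧ evalAt α B ≠ 0 := by
  let e : Fin n × ℕ → Fin (n + 1) × ℕ := Prod.map Fin.castSucc id
  let ρ : DiffPoly F (Fin n) →ₐ[F] DiffPoly F (Fin (n + 1)) := MvPolynomial.rename e
  let z : Fin (n + 1) × ℕ := (Fin.last n, 0)
  have hρ : ∀ f m, ρ f ∈ orderLT F (Fin.last n) m := by
    intro f m
    refine mem_orderLT_iff.2 fun k hk => ?_
    obtain ⟨⟨i, l⟩, -, hi⟩ := MvPolynomial.mem_vars_rename _ _ hk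
    exact absurd (Prod.ext_iff.1 hi).1 (Fin.castSucc_lt_last i).ne
  let P : DiffPoly F (Fin (n + 1)) := ρ B * MvPolynomial.X z - 1
  have hP : P ∈ orderLT F (Fin.last n) (0 + 1) :=
    sub_mem (mul_mem (hρ B _) (X_mem_orderLT fun _ => Nat.one_pos)) (one_mem _)
  have hPz : MvPolynomial.pderiv z P = ρ B := by
    have := pderiv_eq_zero_of_mem_orderLT (hρ B 0)
    simp only [P, map_sub, MvPolynomial.pderiv_mul, MvPolynomial.pderiv_X_self, z, this,
      MvPolynomial.pderiv_one]
    ring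
  let s : Set (DiffPoly F (Fin (n + 1))) :=
    ρ '' J ∪ Set.range fun s => (fun z : DiffPoly F (Fin (n + 1)) => z′)^[s] P
  have hs : IsDifferentialIdeal (Ideal.span s) := by
    refine .span ?_
    rintro _ (⟨f, hf, rfl⟩ | ⟨k, rfl⟩)
    · exact Ideal.subset_span (Or.inl ⟨f′, hJ f hf, rename_deriv _ f⟩)
    · exact Ideal.subset_span (Or.inr ⟨k + 1, Function.iterate_succ_apply' ..⟩)
  have hne : Ideal.span s ≠ ⊤ := by
    -- a point of `J` with `B ≠ 0` over some field extension, which need not be differential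
    obtain ⟨Q, hJQ, hBQ, hQ⟩ : ∃ Q : Ideal (DiffPoly F (Fin n)), J ≤ Q ∧ B ∉ Q ∧ Q.IsPrime := by
      rw [← hp.radical, Ideal.radical_eq_sInf, Ideal.mem_sInf] at hB
      push Not at hB
      obtain ⟨Q, ⟨hJQ, hQ⟩, hBQ⟩ := hB
      exact ⟨Q, hJQ, hBQ, hQ⟩
    let L := FractionRing (DiffPoly F (Fin n) ⧸ Q)
    let π : DiffPoly F (Fin n) →+* L := (algebraMap _ L).comp (Ideal.Quotient.mk Q)
    have hπ : ∀ f, π f = 0 ↔ f ∈ Q := by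
      intro f
      rw [RingHom.comp_apply, map_eq_zero_iff _ (IsFractionRing.injective _ L),
        Ideal.Quotient.eq_zero_iff_mem]
    let θ₀ : DiffPoly F (Fin (n + 1)) →+* L := MvPolynomial.eval₂Hom (π.comp MvPolynomial.C)
      fun v => Fin.lastCases (motive := fun _ => L) (π B)⁻¹
        (fun i => π (MvPolynomial.X (i, v.2))) v.1
    have hθ₀ρ : ∀ f, θ₀ (ρ f) = π f := by
      intro f
      induction f using MvPolynomial.induction_on with
      | C a => simp [ρ, θ₀]
      | add p q hp hq => simp only [map_add, hp, hq]
      | mul_X p w hp => simp only [map_mul, hp]; simp [ρ, θ₀, e]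
    have hπB : π B ≠ 0 := fun h => hBQ ((hπ B).1 h)
    obtain ⟨θ, hθ, hθP⟩ := exists_ringHom_iterate_deriv_eq_zero hP θ₀
      (by
        have : θ₀ (MvPolynomial.X z) = (π B)⁻¹ := by simp [θ₀, z]
        simp only [P, map_sub, map_mul, hθ₀ρ, this, map_one, mul_inv_cancel₀ hπB, sub_self])
      (by rw [hPz, hθ₀ρ]; exact hπB)
    rw [Ideal.ne_top_iff_one]
    intro h1
    have : (1 : DiffPoly F (Fin (n + 1))) ∈ RingHom.ker θ := by
      refine Ideal.span_le.2 ?_ h1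
      rintro _ (⟨f, hf, rfl⟩ | ⟨k, rfl⟩)
      · exact (hθ _ (hρ f _)).trans ((hθ₀ρ f).trans ((hπ f).2 (hJQ hf)))
      · exact hθP k
    exact one_ne_zero ((map_one θ).symm.trans this)
  obtain ⟨α, hα⟩ := h _ hs hne
  refine ⟨α ∘ Fin.castSucc, fun f hf => ?_, fun hB0 => ?_⟩
  · rw [← evalAt_rename]
    exact hα _ (Ideal.subset_span (Or.inl ⟨f, hf, rfl⟩))
  · have hz := hα P (Ideal.subset_span (Or.inr ⟨0, rfl⟩))
    rw [← evalAt_rename] at hB0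
    rw [map_sub, map_mul, map_one] at hz
    rw [show evalAt α (ρ B) = 0 from hB0, zero_mul, zero_sub] at hz
    exact one_ne_zero (neg_eq_zero.1 hz)

end Points

end DiffAlg

theorem theorem3 (F : Type u) [Field F] [CharZero F] [Differential F] :
    List.TFAE [
      -- (a)
      DiffAlg.IsDifferentiallyClosed F,
      -- (b)
      ∀ A B : DiffAlg.DiffPoly F (Fin 1), Irreducible A → ¬ A ∣ B →
        DiffAlg.ord B ≤ DiffAlg.ord A →
        ∃ α : F, DiffAlg.evalAt (fun _ => α) A = 0 ∧ DiffAlg.evalAt (fun _ => α) B ≠ 0 ∧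
          DiffAlg.evalAt (fun _ => α) (DiffAlg.separant A) ≠ 0,
      -- (c)
      ∀ J : Ideal (DiffAlg.DiffPoly F (Fin 1)), DiffAlg.IsDifferentialIdeal J → J.IsPrime →
        ∀ B ∉ J, ∃ α : F,
          (∀ f ∈ J, DiffAlg.evalAt (fun _ => α) f = 0) ∧ DiffAlg.evalAt (fun _ => α) B ≠ 0,
      -- (d)
      ∀ J : Ideal (DiffAlg.DiffPoly F (Fin 1)), DiffAlg.IsDifferentialIdeal J → J.IsRadical →
        ∀ B ∉ J, ∃ α : F,
          (∀ f ∈ J, DiffAlg.evalAt (fun _ => α) f = 0) ∧ DiffAlg.evalAt (fun _ => α) B ≠ 0,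
      -- (e), prime ideals
      ∀ n : ℕ, 1 ≤ n → ∀ J : Ideal (DiffAlg.DiffPoly F (Fin n)),
        DiffAlg.IsDifferentialIdeal J → J.IsPrime →
        ∀ B ∉ J, ∃ α : Fin n → F,
          (∀ f ∈ J, DiffAlg.evalAt α f = 0) ∧ DiffAlg.evalAt α B ≠ 0,
      -- (e), radical ideals
      ∀ n : ℕ, 1 ≤ n → ∀ J : Ideal (DiffAlg.DiffPoly F (Fin n)),
        DiffAlg.IsDifferentialIdeal J → J.IsRadical →
        ∀ B ∉ J, ∃ α : Fin n → F,
          (∀ f ∈ J, DiffAlg.evalAt α f = 0) ∧ DiffAlg.evalAt α B ≠ 0,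
      -- (f)
      ∀ n : ℕ, 1 ≤ n → ∀ J : Ideal (DiffAlg.DiffPoly F (Fin n)),
        DiffAlg.IsDifferentialIdeal J → J.IsPrime →
        ∃ α : Fin n → F, ∀ f ∈ J, DiffAlg.evalAt α f = 0,
      -- (g), arbitrary differential ideals
      ∀ n : ℕ, 1 ≤ n → ∀ J : Ideal (DiffAlg.DiffPoly F (Fin n)),
        DiffAlg.IsDifferentialIdeal J → J ≠ ⊤ →
        ∃ α : Fin n → F, ∀ f ∈ J, DiffAlg.evalAt α f = 0,
      -- (g), radical ideals
      ∀ n : ℕ, 1 ≤ n → ∀ J : Ideal (DiffAlg.DiffPoly F (Fin n)),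
        DiffAlg.IsDifferentialIdeal J → J.IsRadical → J ≠ ⊤ →
        ∃ α : Fin n → F, ∀ f ∈ J, DiffAlg.evalAt α f = 0,
      -- (h)
      ∀ n : ℕ, 1 ≤ n → ∀ J : Ideal (DiffAlg.DiffPoly F (Fin n)),
        DiffAlg.IsMaximalDifferentialIdeal J →
        ∃ α : Fin n → F, ∀ f ∈ J, DiffAlg.evalAt α f = 0,
      -- (i)
      DiffAlg.ChevalleyExtension.{u, v} F] := by
  have one_notMem_radical : ∀ {n : ℕ} {J : Ideal (DiffAlg.DiffPoly F (Fin n))}, J ≠ ⊤ →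
      (1 : DiffAlg.DiffPoly F (Fin n)) ∉ J.radical := fun hJ h =>
    hJ (Ideal.radical_eq_top.1 ((Ideal.eq_top_iff_one _).2 h))
  tfae_have 1 → 11 := fun h => h.chevalleyExtension
  tfae_have 11 → 5 := fun h n _ J hJ hp B hB => h.exists_point hJ hp hB
  tfae_have 5 → 6 := by
    intro h n hn J hJ hr B hB
    obtain ⟨P, hJP, hP, hp, hBP⟩ := hJ.exists_prime (by rwa [hr.radical] : B ∉ J.radical)
    obtain ⟨α, hα, hαB⟩ := h n hn P hP hp B hBP
    exact ⟨α, fun f hf => hα f (hJP hf), hαB⟩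
  tfae_have 6 → 4 := by
    intro h J hJ hr B hB
    obtain ⟨α, hα, hαB⟩ := h 1 le_rfl J hJ hr B hB
    have hα0 : α = fun _ => α 0 := funext fun i => congrArg α (Subsingleton.elim i 0)
    rw [hα0] at hα hαB
    exact ⟨α 0, hα, hαB⟩
  tfae_have 4 → 3 := fun h J hJ hp => h J hJ hp.isRadical
  tfae_have 3 → 4 := by
    intro h J hJ hr B hB
    obtain ⟨P, hJP, hP, hp, hBP⟩ := hJ.exists_prime (by rwa [hr.radical] : B ∉ J.radical)
    obtain ⟨α, hα, hαB⟩ := h P hP hp B hBP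
    exact ⟨α, fun f hf => hα f (hJP hf), hαB⟩
  tfae_have 4 → 2 := by
    intro h A B hA hAB hord
    obtain ⟨α, hα, hαB⟩ := h _ (DiffAlg.isDifferentialIdeal_span_iterate A).radical
      (Ideal.radical_isRadical _) _ (DiffAlg.notMem_radical_span_iterate hA hord hAB)
    rw [map_mul] at hαB
    exact ⟨α, hα A (Ideal.le_radical (Ideal.subset_span ⟨0, rfl⟩)), right_ne_zero_of_mul hαB,
      left_ne_zero_of_mul hαB⟩
  tfae_have 2 → 1 := by
    intro h A B hB hord
    obtain ⟨r, hr, hv⟩ := DiffAlg.exists_mem_vars_of_bot_lt_ord (bot_le.trans_lt hord)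
    -- an irreducible factor of `A` that involves the highest derivative of `y` in `A`
    obtain ⟨p, hp, ⟨q, rfl⟩, hvp⟩ := DiffAlg.exists_irreducible_dvd_mem_vars hv
    have hrp := DiffAlg.le_ord_of_mem_vars hvp
    rw [hr] at hord
    obtain ⟨α, hα, hαB, -⟩ := h p B hp
      (fun hpB => hord.not_ge
        (DiffAlg.le_ord_of_mem_vars (DiffAlg.vars_subset_of_dvd hB hpB hvp)))
      (hord.le.trans hrp)
    exact ⟨α, by rw [map_mul, hα, zero_mul], hαB⟩
  tfae_have 5 → 7 := by
    intro h n hn J hJ hp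
    obtain ⟨α, hα, -⟩ := h n hn J hJ hp 1 ((Ideal.ne_top_iff_one J).1 hp.ne_top)
    exact ⟨α, hα⟩
  tfae_have 7 → 8 := by
    intro h n hn J hJ hne
    obtain ⟨P, hJP, hP, hp, -⟩ := hJ.exists_prime (one_notMem_radical hne)
    obtain ⟨α, hα⟩ := h n hn P hP hp
    exact ⟨α, fun f hf => hα f (hJP hf)⟩
  tfae_have 8 → 9 := fun h n hn J hJ _ => h n hn J hJ
  tfae_have 9 → 7 := fun h n hn J hJ hp => h n hn J hJ hp.isRadical hp.ne_top
  tfae_have 8 → 10 := fun h n hn J hJ => h n hn J hJ.prop.1 hJ.prop.2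
  tfae_have 10 → 8 := by
    intro h n hn J hJ hne
    obtain ⟨M, hJM, hM⟩ := hJ.exists_maximal (one_notMem_radical hne)
    have hM' : DiffAlg.IsMaximalDifferentialIdeal M :=
      ⟨⟨hM.prop.1, fun h => hM.prop.2 (Ideal.le_radical (h ▸ Submodule.mem_top))⟩,
        fun K hK hMK => hM.le_of_ge ⟨hK.1, one_notMem_radical hK.2⟩ hMK⟩
    obtain ⟨α, hα⟩ := h n hn M hM'
    exact ⟨α, fun f hf => hα f (hJM hf)⟩
  tfae_have 8 → 6 := fun h n hn J hJ hr B hB =>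
    DiffAlg.exists_point_of_forall_proper (h (n + 1) n.succ_pos) hJ hr hB
  tfae_finish
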